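/- **Ortholattices and the $n$OA laws.** An ortholattice (OL) is a bounded lattice $(L,\cup,\cap,0,1)$ with an order-reversing involution $a\mapsto a'$ such that $a\cup a'=1$ and $a\cap a'=0$ for all $a$. It is orthomodular (an OML) if $a\le b$ implies $b=a\cup(a'\cap b)$. Put $a\to b=a'\cup(a\cap b)$. For $n\ge 3$ define the operation $\overset{(n)}{\equiv}$ on $n$ variables $a_1,\dots,a_n$ by $$a_1\overset{(3)}{\equiv}a_2=((a_1\to a_3)\cap(a_2\to a_3))\cup((a_1'\to a_3)\cap(a_2'\to a_3)),$$ $$a_1\overset{(n)}{\equiv}a_2=(a_1\overset{(n-1)}{\equiv}a_2)\cup\bigl((a_1\overset{(n-1)}{\equiv}a_n)\cap(a_2\overset{(n-1)}{\equiv}a_n)\bigr)\qquad(n\ge4),$$ where in each subexpression with $\overset{(n-1)}{\equiv}$ only the two explicit variables are substituted and $a_3,\dots,a_{n-1}$ stay the same. The $n$OA law holds in $L$ if $$(a_1\to a_3)\cap(a_1\overset{(n)}{\equiv}a_2)\le a_2\to a_3\qquad\text{for all }a_1,\dots,a_n\in L.$$ **Greechie diagrams.** A (finite) diagram consists of a nonempty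 finite set $V$ of atoms and a set $E$ of nonempty subsets of $V$, called blocks. A loop of order $k$ is a sequence of distinct blocks $e_1,\dots,e_k$ for which there are distinct atoms $\nu_i\in e_i\cap e_{i+1}$ ($i=1,\dots,k$, $e_{k+1}=e_1$). The diagram is a Greechie diagram if every atom lies in a block; every block has at least two atoms if $|V|\ge2$; every block that meets another block has at least three atoms; two different blocks share at most one atom; and there is no loop of order 3. A finite OML $L$ is represented by the diagram if there are bijections between $V$ and the atoms of $L$, and between $E$ and the blocks (maximal Boolean subalgebras) of $L$, that preserve the incidence of atoms and blocks. **Theorem.** 1. For every $n>3$, every ortholattice in which the $n$OA law holds satisfies the $(n-1)$OA law. 2. For $3\le n\le5$ the $n$OA law does not imply the $(n+1)$OA law in ortholattices: there is an ortholattice in which the $n$OA law holds and the $(n+1)$OA law fails. 3. More precisely, for $(n,v,m)=(3,17,10),\ (4,22,13),\ (5,28,18)$ there are a Greechie diagram with $v$ atoms and $m$ blocks, without loops of order 4, and a finite OML represented by it in which the $n$OA law holds and the $(n+1)$OA law fails. -/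

import Mathlib

universe u

/-- An ortholattice: a bounded lattice with an antitone involution `a ↦ aᶜ` that sends every
element to a complement of it. -/
class Ortholattice (L : Type u) extends Lattice L, BoundedOrder L, Compl L where
  compl_involutive : ∀ a : L, aᶜᶜ = a
  compl_antitone : ∀ a b : L, a ≤ b → bᶜ ≤ aᶜ
  sup_compl_top : ∀ a : L, a ⊔ aᶜ = ⊤
  inf_compl_bot : ∀ a : L, a ⊓ aᶜ = ⊥

namespace Ortholattice

/-- The orthomodular law. -/
def IsOrthomodular (L : Type u) [Ortholattice L] : Prop :=
  ∀ a b : L, a ≤ b → b = a ⊔ (aᶜ ⊓ b)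

/-- The implication `a → b = a' ∪ (a ∩ b)`. -/
def sasaki {L : Type u} [Ortholattice L] (a b : L) : L := aᶜ ⊔ (a ⊓ b)

/-- `oaEquivAux a k x y` is `x ≡⁽ᵏ⁺³⁾ y`, where `x` and `y` are the two explicit variables and
`a 3, a 4, …, a (k + 3)` are the implicit ones. -/
def oaEquivAux {L : Type u} [Ortholattice L] (a : ℕ → L) : ℕ → L → L → L
  | 0, x, y =>
      (sasaki x (a 3) ⊓ sasaki y (a 3)) ⊔ (sasaki xᶜ (a 3) ⊓ sasaki yᶜ (a 3))
  | k + 1, x, y =>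
      oaEquivAux a k x y ⊔ (oaEquivAux a k x (a (k + 4)) ⊓ oaEquivAux a k y (a (k + 4)))

/-- The operation `x ≡⁽ⁿ⁾ y` with implicit variables `a 3, …, a n`; meant for `3 ≤ n`. -/
def oaEquiv {L : Type u} [Ortholattice L] (n : ℕ) (a : ℕ → L) (x y : L) : L :=
  oaEquivAux a (n - 3) x y

/-- The `n`OA law holds in `L` (meant for `3 ≤ n`). The variables are `a 1, …, a n`; the other
values of `a` do not occur in the inequality. -/
def OALaw (n : ℕ) (L : Type u) [Ortholattice L] : Prop :=
  ∀ a : ℕ → L, sasaki (a 1) (a 3) ⊓ oaEquiv n a (a 1) (a 2) ≤ sasaki (a 2) (a 3)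

/-- `B` is a Boolean subalgebra of `L`: a subset that contains the bounds, is closed under
the operations of `L`, and in which the distributive law holds. -/
structure IsBooleanSubalgebra {L : Type u} [Ortholattice L] (B : Set L) : Prop where
  bot_mem : ⊥ ∈ B
  top_mem : ⊤ ∈ B
  compl_mem : ∀ x ∈ B, xᶜ ∈ B
  sup_mem : ∀ x ∈ B, ∀ y ∈ B, x ⊔ y ∈ B
  inf_mem : ∀ x ∈ B, ∀ y ∈ B, x ⊓ y ∈ B
  inf_sup_distrib : ∀ x ∈ B, ∀ y ∈ B, ∀ z ∈ B, x ⊓ (y ⊔ z) = (x ⊓ y) ⊔ (x ⊓ z)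

/-- A block of `L` is a maximal Boolean subalgebra. -/
def IsBlock {L : Type u} [Ortholattice L] (B : Set L) : Prop :=
  Maximal IsBooleanSubalgebra B

end Ortholattice

/-- A diagram on a nonempty set `V` of atoms with finitely many blocks, which are nonempty finite
sets of atoms. -/
structure OrthoDiagram (V : Type) where
  atoms_nonempty : Nonempty V
  blocks : Finset (Finset V)
  block_nonempty : ∀ e ∈ blocks, e.Nonempty

namespace OrthoDiagram

/-- A loop of order `n`: distinct blocks `e₁, …, eₙ` and distinct atoms `ν₁, …, νₙ` with
`νᵢ ∈ eᵢ ∩ eᵢ₊₁`, the indices being taken cyclically. -/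
def HasLoop {V : Type} (D : OrthoDiagram V) (n : ℕ) : Prop :=
  ∃ e : Fin n → Finset V, ∃ ν : Fin n → V,
    Function.Injective e ∧ Function.Injective ν ∧
    (∀ i, e i ∈ D.blocks) ∧ ∀ i, ν i ∈ e i ∧ ν i ∈ e (finRotate n i)

/-- Greechie diagrams. -/
structure IsGreechie {V : Type} [DecidableEq V] (D : OrthoDiagram V) : Prop where
  atom_mem_block : ∀ v : V, ∃ e ∈ D.blocks, v ∈ e
  two_le_card : (∃ v w : V, v ≠ w) → ∀ e ∈ D.blocks, 2 ≤ e.card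
  three_le_card : ∀ e ∈ D.blocks, ∀ f ∈ D.blocks, e ≠ f → (e ∩ f).Nonempty → 3 ≤ e.card
  inter_card_le_one : ∀ e ∈ D.blocks, ∀ f ∈ D.blocks, e ≠ f → (e ∩ f).card ≤ 1
  no_loop_three : ¬ D.HasLoop 3

/-- `L` is the finite orthomodular lattice of the diagram `D`: there are one-to-one
correspondences between the atoms of `D` and those of `L`, and between the blocks of `D` and those
of `L`, that preserve incidence. -/
def Represents {V : Type} (D : OrthoDiagram V) (L : Type) [Ortholattice L] : Prop :=
  Finite L ∧ Ortholattice.IsOrthomodular L ∧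
    ∃ (f : V ≃ {a : L // IsAtom a})
      (g : {e : Finset V // e ∈ D.blocks} ≃ {B : Set L // Ortholattice.IsBlock B}),
      ∀ v e, v ∈ e.1 ↔ (f v : L) ∈ (g e).1

end OrthoDiagram

/-- Some Greechie diagram with `v` atoms and `m` blocks and without loops of order 4 has an
orthomodular lattice in which the `n`OA law holds and the `(n+1)`OA law fails. -/
def HasGreechieWitness (n v m : ℕ) : Prop :=
  ∃ D : OrthoDiagram (Fin v), D.IsGreechie ∧ ¬ D.HasLoop 4 ∧ D.blocks.card = m ∧
    ∃ (L : Type) (_ : Ortholattice L),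
      D.Represents L ∧ Ortholattice.OALaw n L ∧ ¬ Ortholattice.OALaw (n + 1) L

/-! Part 1 holds because `≡⁽ⁿ⁾` is the join of `≡⁽ⁿ⁻¹⁾` with a further term: the `n`OA law has the
larger left side, so it is the stronger law.

Parts 2 and 3 come from three explicit diagrams with three-element blocks, in which two distinct
atoms never have two common orthogonal atoms. This one condition excludes loops of order 3 and 4 and
makes the lattice very small: the polars of sets of atoms are only the empty set, the singletons,
the neighbourhoods of atoms, and the whole set. So bottom, top, atoms and coatoms form an
orthomodular lattice with `2v + 2` elements, whose Boolean subalgebras are controlled by sets of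
pairwise orthogonal atoms, that is, by blocks (`Elem.represents`).

A law fails at one explicit assignment. That a law holds is a finite check over all assignments,
made feasible in two ways. For fixed `a₃`, the operation `≡` is refined by one implicit variable at
a time, and a variable that does not enlarge it is skipped, since the operation stays the same
(`OADepth.bound_foldl`). Moreover the whole table of an operation is packed into one natural number,
with a lane of `v` bits for each pair `(x, y)`, so that a few arithmetic and bitwise operations
compute a lattice operation in all entries at once (`oaLaw_of_test`). The tests are written mostly
with bare `Nat` operations and `cond`, which suits evaluation by `decide +kernel`. -/

/-- A diagram whose blocks have three atoms and in which two distinct atoms have at most one common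
orthogonal atom. -/
structure TripleSystem (V : Type) [DecidableEq V] where
  diagram : OrthoDiagram V
  card_three : ∀ e ∈ diagram.blocks, e.card = 3
  cover : ∀ v : V, ∃ e ∈ diagram.blocks, v ∈ e
  unique : ∀ a b c d : V, a ≠ b →
    (a ≠ c ∧ ∃ e ∈ diagram.blocks, a ∈ e ∧ c ∈ e) → (b ≠ c ∧ ∃ e ∈ diagram.blocks, b ∈ e ∧ c ∈ e) →
    (a ≠ d ∧ ∃ e ∈ diagram.blocks, a ∈ e ∧ d ∈ e) → (b ≠ d ∧ ∃ e ∈ diagram.blocks, b ∈ e ∧ d ∈ e) →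
    c = d

/-! ### Orthogonality of atoms and the absence of short loops -/

namespace TripleSystem

variable {V : Type} [DecidableEq V]

/-- Two atoms are orthogonal if they are distinct atoms of a common block. -/
def Perp (T : TripleSystem V) (a b : V) : Prop :=
  a ≠ b ∧ ∃ e ∈ T.diagram.blocks, a ∈ e ∧ b ∈ e

variable {T : TripleSystem V}

theorem Perp.symm {a b : V} (h : T.Perp a b) : T.Perp b a :=
  ⟨h.1.symm, h.2.imp fun _ he => ⟨he.1, he.2.2, he.2.1⟩⟩

theorem perp_comm {a b : V} : T.Perp a b ↔ T.Perp b a := ⟨Perp.symm, Perp.symm⟩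

theorem Perp.irrefl {a : V} (h : T.Perp a a) : False := h.1 rfl

theorem Perp.eq_of_common {a b c d : V} (hab : a ≠ b) (h₁ : T.Perp a c) (h₂ : T.Perp b c)
    (h₃ : T.Perp a d) (h₄ : T.Perp b d) : c = d :=
  T.unique a b c d hab h₁ h₂ h₃ h₄

theorem perp_of_mem {e : Finset V} (he : e ∈ T.diagram.blocks) {a b : V} (ha : a ∈ e) (hb : b ∈ e)
    (hab : a ≠ b) : T.Perp a b :=
  ⟨hab, e, he, ha, hb⟩

theorem exists_third {e : Finset V} (he : e ∈ T.diagram.blocks) {a b : V} (ha : a ∈ e) (hb : b ∈ e)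
    (hab : a ≠ b) : ∃ c, c ≠ a ∧ c ≠ b ∧ e = {a, b, c} := by
  have h := T.card_three e he
  have h2 : ((e.erase a).erase b).card = 1 := by
    rw [Finset.card_erase_of_mem (Finset.mem_erase.2 ⟨hab.symm, hb⟩), Finset.card_erase_of_mem ha, h]
  obtain ⟨c, hc⟩ := Finset.card_eq_one.1 h2
  have hmem : c ∈ (e.erase a).erase b := by simp [hc]
  simp only [Finset.mem_erase] at hmem
  refine ⟨c, hmem.2.1, hmem.1, ?_⟩
  rw [← Finset.insert_erase ha, ← Finset.insert_erase (Finset.mem_erase.2 ⟨hab.symm, hb⟩), hc]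

theorem Perp.exists_perp_perp {a b : V} (h : T.Perp a b) : ∃ c, T.Perp c a ∧ T.Perp c b := by
  obtain ⟨hab, e, he, ha, hb⟩ := h
  obtain ⟨c, hca, hcb, rfl⟩ := exists_third he ha hb hab
  exact ⟨c, perp_of_mem he (by simp) ha hca, perp_of_mem he (by simp) hb hcb⟩

theorem exists_perp (T : TripleSystem V) (v : V) : ∃ a b, a ≠ b ∧ T.Perp a v ∧ T.Perp b v := by
  obtain ⟨e, he, hv⟩ := T.cover v
  obtain ⟨a, ha, hav⟩ := Finset.exists_mem_ne (by rw [T.card_three e he]; norm_num) v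
  obtain ⟨b, hb⟩ := (perp_of_mem he ha hv hav).exists_perp_perp
  exact ⟨a, b, fun h => (h ▸ hb.1).irrefl, perp_of_mem he ha hv hav, hb.2⟩

/-- The third atom of the block is already a common orthogonal atom of `a` and `b`, and there is
only one. -/
theorem mem_of_perp_perp {e : Finset V} (he : e ∈ T.diagram.blocks) {a b c : V} (ha : a ∈ e)
    (hb : b ∈ e) (hab : a ≠ b) (hca : T.Perp c a) (hcb : T.Perp c b) : c ∈ e := by
  obtain ⟨d, hda, hdb, rfl⟩ := exists_third he ha hb hab
  have : c = d := Perp.eq_of_common hab hca.symm hcb.symm (perp_of_mem he ha (by simp) hda.symm)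
    (perp_of_mem he hb (by simp) hdb.symm)
  simp [this]

theorem block_eq {e f : Finset V} (he : e ∈ T.diagram.blocks) (hf : f ∈ T.diagram.blocks) {a b : V}
    (hab : a ≠ b) (hae : a ∈ e) (hbe : b ∈ e) (haf : a ∈ f) (hbf : b ∈ f) : e = f := by
  refine Finset.eq_of_subset_of_card_le (fun c hc => ?_)
    (by rw [T.card_three e he, T.card_three f hf])
  by_cases hca : c = a
  · rwa [hca]
  by_cases hcb : c = b
  · rwa [hcb]
  exact mem_of_perp_perp hf haf hbf hab (perp_of_mem he hc hae hca) (perp_of_mem he hc hbe hcb)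

/-- `ν 1` is orthogonal to the atoms `ν 0` and `ν 2` of `e 0`, hence lies in `e 0`; then `e 0` and
`e 1` share two atoms. -/
theorem no_loop_three (T : TripleSystem V) : ¬ T.diagram.HasLoop 3 := by
  rintro ⟨e, ν, he, hν, hmem, hinc⟩
  have h0 := hinc 0
  have h1 := hinc 1
  have h2 := hinc 2
  simp only [show finRotate 3 0 = 1 from rfl, show finRotate 3 1 = 2 from rfl,
    show finRotate 3 2 = 0 from rfl] at h0 h1 h2
  have n01 : ν 0 ≠ ν 1 := hν.ne (by decide)
  have n12 : ν 1 ≠ ν 2 := hν.ne (by decide)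
  have n02 : ν 0 ≠ ν 2 := hν.ne (by decide)
  have : ν 1 ∈ e 0 := mem_of_perp_perp (hmem 0) h0.1 h2.2 n02
    (perp_of_mem (hmem 1) h1.1 h0.2 n01.symm) (perp_of_mem (hmem 2) h1.2 h2.1 n12)
  exact absurd (he (block_eq (hmem 0) (hmem 1) n01 h0.1 this h0.2 h1.1)) (by decide)

/-- The opposite corners `ν 1` and `ν 3` would both be orthogonal to `ν 0` and `ν 2`. -/
theorem no_loop_four (T : TripleSystem V) : ¬ T.diagram.HasLoop 4 := by
  rintro ⟨e, ν, he, hν, hmem, hinc⟩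
  have h0 := hinc 0
  have h1 := hinc 1
  have h2 := hinc 2
  have h3 := hinc 3
  simp only [show finRotate 4 0 = 1 from rfl, show finRotate 4 1 = 2 from rfl,
    show finRotate 4 2 = 3 from rfl, show finRotate 4 3 = 0 from rfl] at h0 h1 h2 h3
  have : ν 1 = ν 3 := Perp.eq_of_common (hν.ne (show (0 : Fin 4) ≠ 2 by decide))
    (perp_of_mem (hmem 1) h0.2 h1.1 (hν.ne (by decide)))
    (perp_of_mem (hmem 2) h2.1 h1.2 (hν.ne (by decide)))
    (perp_of_mem (hmem 0) h0.1 h3.2 (hν.ne (by decide)))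
    (perp_of_mem (hmem 3) h2.2 h3.1 (hν.ne (by decide)))
  exact absurd (hν this) (by decide)

theorem isGreechie (T : TripleSystem V) : T.diagram.IsGreechie where
  atom_mem_block := T.cover
  two_le_card _ e he := by rw [T.card_three e he]; norm_num
  three_le_card e he _ _ _ _ := (T.card_three e he).ge
  inter_card_le_one e he f hf hef := by
    by_contra! h
    obtain ⟨a, ha, b, hb, hab⟩ := Finset.one_lt_card.1 h
    rw [Finset.mem_inter] at ha hb
    exact hef (block_eq he hf hab ha.1 hb.1 ha.2 hb.2)
  no_loop_three := T.no_loop_three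

/-! ### The orthomodular lattice of a triple system -/

/-- The elements of the lattice of a triple system. -/
inductive Elem (T : TripleSystem V) : Type u
  | bot
  | top
  | atom (v : V)
  | coatom (v : V)

namespace Elem

/-- The atoms below an element. -/
def atoms : Elem.{u} T → Set V
  | bot => ∅
  | top => Set.univ
  | atom v => {v}
  | coatom v => {w | T.Perp w v}

/-- The orthocomplement. -/
def compl : Elem.{u} T → Elem.{u} T
  | bot => top
  | top => bot
  | atom v => coatom v
  | coatom v => atom v

/-- So `compl` is the polarity of the orthogonality relation. For a coatom, two distinct atoms
orthogonal to `v` have no common orthogonal atom besides `v`. -/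
theorem mem_atoms_compl (x : Elem.{u} T) (t : V) :
    t ∈ x.compl.atoms ↔ ∀ s ∈ x.atoms, T.Perp s t := by
  cases x with
  | bot => simp [compl, atoms]
  | top => simpa [compl, atoms] using ⟨t, fun h => h.irrefl⟩
  | atom v => simp [compl, atoms, perp_comm]
  | coatom v =>
    simp only [compl, atoms, Set.mem_singleton_iff, Set.mem_ofPred_eq]
    refine ⟨fun h s hs => h ▸ hs, fun h => ?_⟩
    obtain ⟨a, b, hab, ha, hb⟩ := T.exists_perp v
    exact Perp.eq_of_common hab (h a ha) (h b hb) ha hb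

/-- A neighbourhood has at least two atoms and omits its centre, so it is none of the other sets;
any two of its atoms determine the centre. -/
theorem atoms_injective : Function.Injective (atoms : Elem.{u} T → Set V) := by
  have hne (v : V) : ∃ a b, a ≠ b ∧ a ∈ (coatom v : Elem.{u} T).atoms ∧
      b ∈ (coatom v : Elem.{u} T).atoms := T.exists_perp v
  have hnot (v : V) : v ∉ (coatom v : Elem.{u} T).atoms := fun h => h.irrefl
  have hatom (v w : V) : (atom v : Elem.{u} T).atoms ≠ (coatom w : Elem.{u} T).atoms := by
    intro h
    obtain ⟨a, b, hab, ha, hb⟩ := hne w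
    rw [← h] at ha hb
    exact hab (ha.trans hb.symm)
  have htop (v : V) : (top : Elem.{u} T).atoms ≠ (coatom v : Elem.{u} T).atoms :=
    fun h => hnot v (h ▸ Set.mem_univ v)
  have hbot (v : V) : (bot : Elem.{u} T).atoms ≠ (coatom v : Elem.{u} T).atoms := by
    intro h
    obtain ⟨a, -, -, ha, -⟩ := hne v
    rw [← h] at ha
    exact ha
  have hbt : (bot : Elem.{u} T).atoms ≠ (top : Elem.{u} T).atoms := by
    obtain ⟨v⟩ := T.diagram.atoms_nonempty
    exact fun h => (Set.eq_empty_iff_forall_notMem.1 h.symm) v trivial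
  have hba (v : V) : (bot : Elem.{u} T).atoms ≠ (atom v : Elem.{u} T).atoms :=
    (Set.singleton_ne_empty v).symm
  have hta (v : V) : (top : Elem.{u} T).atoms ≠ (atom v : Elem.{u} T).atoms := by
    intro h
    obtain ⟨a, b, hab, -, -⟩ := T.exists_perp v
    have ha : a ∈ (atom v : Elem.{u} T).atoms := h ▸ Set.mem_univ a
    have hb : b ∈ (atom v : Elem.{u} T).atoms := h ▸ Set.mem_univ b
    exact hab (ha.trans hb.symm)
  intro x y h
  cases x with
  | bot =>
    cases y with
    | bot => rfl
    | top => exact absurd h hbt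
    | atom w => exact absurd h (hba w)
    | coatom w => exact absurd h (hbot w)
  | top =>
    cases y with
    | bot => exact absurd h hbt.symm
    | top => rfl
    | atom w => exact absurd h (hta w)
    | coatom w => exact absurd h (htop w)
  | atom v =>
    cases y with
    | bot => exact absurd h (hba v).symm
    | top => exact absurd h (hta v).symm
    | atom w => rw [Set.singleton_injective h]
    | coatom w => exact absurd h (hatom v w)
  | coatom v =>
    cases y with
    | bot => exact absurd h (hbot v).symm
    | top => exact absurd h (htop v).symm
    | atom w => exact absurd h (hatom w v).symm
    | coatom w =>
      obtain ⟨a, b, hab, ha, hb⟩ := hne v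
      have ha' := ha
      have hb' := hb
      rw [h] at ha' hb'
      rw [Perp.eq_of_common hab ha hb ha' hb']

/-- This is where the diagram condition makes the four kinds of elements a lattice: two different
neighbourhoods meet in at most one atom, so no new sets arise. -/
theorem exists_atoms_eq_inter (x y : Elem.{u} T) : ∃ z : Elem.{u} T, z.atoms = x.atoms ∩ y.atoms := by
  have hsub (s : Set V) (hs : ∀ a ∈ s, ∀ b ∈ s, a = b) : ∃ z : Elem.{u} T, z.atoms = s := by
    rcases s.eq_empty_or_nonempty with rfl | ⟨a, ha⟩
    · exact ⟨bot, rfl⟩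
    · exact ⟨atom a, Set.eq_singleton_iff_unique_mem.2 ⟨ha, fun b hb => hs b hb a ha⟩ |>.symm⟩
  cases x with
  | bot => exact ⟨bot, (Set.empty_inter _).symm⟩
  | top => exact ⟨y, (Set.univ_inter _).symm⟩
  | atom v => exact hsub _ fun a ha b hb => ha.1.trans hb.1.symm
  | coatom v =>
    cases y with
    | bot => exact ⟨bot, (Set.inter_empty _).symm⟩
    | top => exact ⟨coatom v, (Set.inter_univ _).symm⟩
    | atom w => exact hsub _ fun a ha b hb => ha.2.trans hb.2.symm
    | coatom w =>
      by_cases hvw : v = w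
      · exact ⟨coatom v, by rw [hvw, Set.inter_self]⟩
      · exact hsub _ fun a ha b hb =>
          Perp.eq_of_common hvw ha.1.symm ha.2.symm hb.1.symm hb.2.symm

theorem compl_compl (x : Elem.{u} T) : x.compl.compl = x := by cases x <;> rfl

theorem atoms_compl_anti {x y : Elem.{u} T} (h : x.atoms ⊆ y.atoms) :
    y.compl.atoms ⊆ x.compl.atoms :=
  fun t ht => (mem_atoms_compl x t).2 fun s hs => (mem_atoms_compl y t).1 ht s (h hs)

/-- The meet of two elements. -/
noncomputable def meet (x y : Elem.{u} T) : Elem.{u} T := (exists_atoms_eq_inter x y).choose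

theorem atoms_meet (x y : Elem.{u} T) : (meet x y).atoms = x.atoms ∩ y.atoms :=
  (exists_atoms_eq_inter x y).choose_spec

instance : PartialOrder (Elem.{u} T) := PartialOrder.lift atoms atoms_injective

theorem le_def {x y : Elem.{u} T} : x ≤ y ↔ x.atoms ⊆ y.atoms := Iff.rfl

theorem compl_le_comm {x y : Elem.{u} T} (h : x.compl ≤ y) : y.compl ≤ x := by
  simpa only [compl_compl] using (show y.compl ≤ x.compl.compl from atoms_compl_anti h)

theorem meet_le_left (x y : Elem.{u} T) : meet x y ≤ x := by
  rw [le_def, atoms_meet]; exact Set.inter_subset_left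

theorem meet_le_right (x y : Elem.{u} T) : meet x y ≤ y := by
  rw [le_def, atoms_meet]; exact Set.inter_subset_right

theorem meet_compl (x : Elem.{u} T) : meet x x.compl = bot := by
  apply atoms_injective
  rw [atoms_meet]
  exact Set.eq_empty_of_forall_notMem fun s hs => ((mem_atoms_compl x s).1 hs.2 s hs.1).irrefl

noncomputable instance : Ortholattice (Elem.{u} T) where
  sup x y := (meet x.compl y.compl).compl
  inf := meet
  top := top
  bot := bot
  compl := compl
  le_top x := Set.subset_univ x.atoms
  bot_le x := Set.empty_subset x.atoms
  inf_le_left := meet_le_left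
  inf_le_right := meet_le_right
  le_inf x y z hy hz := by
    rw [le_def, atoms_meet]; exact Set.subset_inter hy hz
  le_sup_left x y := by
    simpa only [compl_compl] using
      (show x.compl.compl ≤ _ from atoms_compl_anti (meet_le_left x.compl y.compl))
  le_sup_right x y := by
    simpa only [compl_compl] using
      (show y.compl.compl ≤ _ from atoms_compl_anti (meet_le_right x.compl y.compl))
  sup_le x y z hx hy := by
    apply compl_le_comm
    rw [le_def, atoms_meet]
    exact Set.subset_inter (atoms_compl_anti hx) (atoms_compl_anti hy)
  compl_involutive := compl_compl
  compl_antitone _ _ h := atoms_compl_anti h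
  sup_compl_top x := by
    change (meet x.compl x.compl.compl).compl = top
    rw [meet_compl]; rfl
  inf_compl_bot := meet_compl

theorem atom_le_iff {v : V} {x : Elem.{u} T} : atom v ≤ x ↔ v ∈ x.atoms := Set.singleton_subset_iff

theorem le_iff {x y : Elem.{u} T} : x ≤ y ↔ ∀ v, atom v ≤ x → atom v ≤ y := by
  simp only [atom_le_iff]; rfl

theorem atom_le_compl_iff {v : V} {x : Elem.{u} T} :
    atom v ≤ xᶜ ↔ ∀ s, atom s ≤ x → T.Perp s v := by
  simp only [atom_le_iff]; exact mem_atoms_compl x v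

theorem compl_atom (v : V) : (atom v : Elem.{u} T)ᶜ = coatom v := rfl

theorem compl_coatom (v : V) : (coatom v : Elem.{u} T)ᶜ = atom v := rfl

theorem atom_le_atom {v w : V} : (atom v : Elem.{u} T) ≤ atom w ↔ v = w := atom_le_iff

theorem atom_le_coatom {v w : V} : (atom v : Elem.{u} T) ≤ coatom w ↔ T.Perp v w := atom_le_iff

theorem top_le_sup_compl_inf_top (x : Elem.{u} T) : (top : Elem.{u} T) ≤ x ⊔ xᶜ ⊓ top := by
  change ⊤ ≤ x ⊔ xᶜ ⊓ ⊤
  rw [inf_top_eq, Ortholattice.sup_compl_top]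

/-- The only substantial case is `v` orthogonal to `w`: with `c` the third atom of their block, `w`
is the only atom orthogonal to both `v` and `c`, so the join of `v` and `c` is the coatom of `w`. -/
theorem isOrthomodular : Ortholattice.IsOrthomodular (Elem.{u} T) := by
  intro a b hab
  refine le_antisymm ?_ (sup_le hab inf_le_right)
  cases a with
  | bot => exact le_sup_of_le_right (le_inf le_top le_rfl)
  | top => exact le_sup_of_le_left le_top
  | atom v =>
    cases b with
    | bot => exact bot_le
    | top => exact top_le_sup_compl_inf_top _
    | atom w => rw [atom_le_atom.1 hab]; exact le_sup_left
    | coatom w =>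
      obtain ⟨c, hcv, hcw⟩ := (atom_le_coatom.1 hab).exists_perp_perp
      have h : (atom v : Elem.{u} T) ⊔ atom c ≤ atom v ⊔ (atom v)ᶜ ⊓ coatom w :=
        sup_le_sup_left (le_inf (atom_le_coatom.2 hcv) (atom_le_coatom.2 hcw)) _
      refine le_trans ?_ h
      refine Ortholattice.compl_antitone ((atom v : Elem.{u} T).compl ⊓ (atom c).compl) (atom w) ?_
      refine le_iff.2 fun t ht => atom_le_atom.2 ?_
      have h₁ := atom_le_coatom.1 (ht.trans inf_le_left)
      have h₂ := atom_le_coatom.1 (ht.trans inf_le_right)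
      exact Perp.eq_of_common (fun h => (h ▸ hcv).irrefl) h₁.symm h₂.symm
        (atom_le_coatom.1 hab) hcw
  | coatom v =>
    cases b with
    | bot => exact bot_le
    | top => exact top_le_sup_compl_inf_top _
    | atom w =>
      obtain ⟨a, b, hne, ha, hb⟩ := T.exists_perp v
      exact absurd ((hab ha : a = w).trans (hab hb : b = w).symm) hne
    | coatom w =>
      obtain ⟨a, b, hne, ha, hb⟩ := T.exists_perp v
      rw [Perp.eq_of_common hne (hab ha) (hab hb) ha hb]
      exact le_sup_left

end Elem
end TripleSystem

/-! ### Maximal Boolean subalgebras correspond to blocks -/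

namespace TripleSystem
variable {V : Type} [DecidableEq V] {T : TripleSystem V}
namespace Elem

theorem eq_of_atom_le_iff {x y : Elem.{u} T} (h : ∀ v, atom v ≤ x ↔ atom v ≤ y) : x = y :=
  le_antisymm (le_iff.2 fun v => (h v).1) (le_iff.2 fun v => (h v).2)

theorem atom_not_le_bot (v : V) : ¬ (atom v : Elem.{u} T) ≤ ⊥ := fun h => atom_le_iff.1 h

theorem isAtom_atom (v : V) : IsAtom (atom v : Elem.{u} T) := by
  refine ⟨fun h => atom_not_le_bot v h.le, fun x hx => ?_⟩
  refine eq_of_atom_le_iff fun w => ⟨fun hw => ?_, fun hw => hw.trans bot_le⟩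
  rw [← atom_le_atom.1 (hw.trans hx.le)] at hx
  exact absurd hw hx.not_ge

theorem isAtom_iff {x : Elem.{u} T} : IsAtom x ↔ ∃ v, x = atom v := by
  refine ⟨fun hx => ?_, fun ⟨v, hv⟩ => hv ▸ isAtom_atom v⟩
  by_contra! h
  refine hx.1 (eq_of_atom_le_iff fun v => ⟨fun hv => ?_, fun hv => hv.trans bot_le⟩)
  exact absurd ((hx.le_iff_eq (isAtom_atom v).1).1 hv).symm (h v)

theorem atom_injective : Function.Injective (atom : V → Elem.{u} T) := fun _ _ h => by
  injection h

/-- The elements of the lattice that are made from a block. -/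
def ofBlock (T : TripleSystem V) (e : Finset V) : Set (Elem.{u} T) :=
  {x | x = ⊥ ∨ x = ⊤ ∨ ∃ v ∈ e, x = atom v ∨ x = coatom v}

theorem atom_mem_ofBlock {e : Finset V} {v : V} : (atom v : Elem.{u} T) ∈ ofBlock T e ↔ v ∈ e := by
  constructor
  · rintro (h | h | ⟨w, hw, h | h⟩)
    · exact absurd h.le (atom_not_le_bot v)
    · cases h
    · rwa [atom_injective h]
    · cases h
  · exact fun h => Or.inr (Or.inr ⟨v, h, Or.inl rfl⟩)

theorem compl_mem_ofBlock {e : Finset V} {x : Elem.{u} T} (hx : x ∈ ofBlock T e) :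
    xᶜ ∈ ofBlock T e := by
  rcases hx with rfl | rfl | ⟨v, hv, rfl | rfl⟩
  · exact Or.inr (Or.inl rfl)
  · exact Or.inl rfl
  · exact Or.inr (Or.inr ⟨v, hv, Or.inr rfl⟩)
  · exact Or.inr (Or.inr ⟨v, hv, Or.inl rfl⟩)

/-- Restricted to the atoms of the block, the orthocomplement is the set complement. This turns
distributivity into propositional logic. -/
theorem atom_le_compl_iff_of_mem {e : Finset V} (he : e ∈ T.diagram.blocks) {x : Elem.{u} T}
    (hx : x ∈ ofBlock T e) {v : V} (hv : v ∈ e) : atom v ≤ xᶜ ↔ ¬ atom v ≤ x := by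
  rcases hx with rfl | rfl | ⟨w, hw, rfl | rfl⟩
  · exact iff_of_true (show (atom v : Elem.{u} T) ≤ ⊤ from le_top) (atom_not_le_bot v)
  · exact iff_of_false (atom_not_le_bot v) (not_not.2 le_top)
  · rw [compl_atom, atom_le_coatom, atom_le_atom]
    exact ⟨fun h => h.1, perp_of_mem he hv hw⟩
  · rw [compl_coatom, atom_le_coatom, atom_le_atom]
    exact ⟨fun h h' => h'.1 h, fun h => by_contra fun h' => h (perp_of_mem he hv hw h')⟩

theorem inf_mem_ofBlock {e : Finset V} (he : e ∈ T.diagram.blocks) {x y : Elem.{u} T}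
    (hx : x ∈ ofBlock T e) (hy : y ∈ ofBlock T e) : x ⊓ y ∈ ofBlock T e := by
  have hatom {v : V} (hv : v ∈ e) (z : Elem.{u} T) : atom v ⊓ z ∈ ofBlock T e := by
    rcases (isAtom_atom v).le_iff.1 (inf_le_left : atom v ⊓ z ≤ atom v) with h | h
    · exact Or.inl h
    · rw [h]; exact atom_mem_ofBlock.2 hv
  have hx' := hx
  have hy' := hy
  rcases hx with rfl | rfl | ⟨v, hv, rfl | rfl⟩
  · rwa [bot_inf_eq]
  · rwa [top_inf_eq]
  · exact hatom hv y
  rcases hy with rfl | rfl | ⟨w, hw, rfl | rfl⟩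
  · rwa [inf_bot_eq]
  · rwa [inf_top_eq]
  · rw [inf_comm]; exact hatom hw _
  by_cases hvw : v = w
  · rwa [hvw, inf_idem, ← hvw]
  obtain ⟨c, hcv, hcw, rfl⟩ := exists_third he hv hw hvw
  have hcv' := perp_of_mem he (by simp) hv hcv
  have hcw' := perp_of_mem he (by simp) hw hcw
  have : (coatom v ⊓ coatom w : Elem.{u} T) = atom c := by
    refine eq_of_atom_le_iff fun t => ?_
    rw [le_inf_iff, atom_le_coatom, atom_le_coatom, atom_le_atom]
    exact ⟨fun h => Perp.eq_of_common hvw h.1.symm h.2.symm hcv'.symm hcw'.symm,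
      fun h => h ▸ ⟨hcv', hcw'⟩⟩
  rw [this]
  exact atom_mem_ofBlock.2 (by simp)

theorem compl_inf (x y : Elem.{u} T) : (xᶜ ⊓ yᶜ)ᶜ = x ⊔ y := rfl

theorem eq_of_mem_ofBlock {e : Finset V} (he : e ∈ T.diagram.blocks) {x y : Elem.{u} T}
    (hx : x ∈ ofBlock T e) (hy : y ∈ ofBlock T e) (h : ∀ v ∈ e, atom v ≤ x ↔ atom v ≤ y) :
    x = y := by
  have hle {x y : Elem.{u} T} (hx : x ∈ ofBlock T e) (hy : y ∈ ofBlock T e)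
      (h : ∀ v ∈ e, atom v ≤ x → atom v ≤ y) : x ≤ y := by
    -- An element of `ofBlock T e` above the two atoms of the block other than `v` can only be the
    -- top or the coatom of `v`.
    have hco {v : V} (hv : v ∈ e) (h : ∀ w ∈ e, T.Perp w v → atom w ≤ y) : coatom v ≤ y := by
      obtain ⟨a, ha, hav⟩ := Finset.exists_mem_ne (by rw [T.card_three e he]; norm_num) v
      obtain ⟨b, hba, hbv, rfl⟩ := exists_third he ha hv hav
      have ha' := perp_of_mem he ha hv hav
      have hb' := perp_of_mem he (by simp) hv hbv
      have h₁ := h a ha ha'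
      have h₂ := h b (by simp) hb'
      rcases hy with rfl | rfl | ⟨w, hw, rfl | rfl⟩
      · exact absurd h₁ (atom_not_le_bot a)
      · exact le_top
      · exact absurd ((atom_le_atom.1 h₂).trans (atom_le_atom.1 h₁).symm) hba
      · rw [Perp.eq_of_common hba.symm ha' hb' (atom_le_coatom.1 h₁) (atom_le_coatom.1 h₂)]
    rcases hx with rfl | rfl | ⟨v, hv, rfl | rfl⟩
    · exact bot_le
    · obtain ⟨v, hv⟩ := T.diagram.block_nonempty e he
      have h₁ := h v hv le_top
      have h₂ : (coatom v : Elem.{u} T) ≤ y := hco hv fun w hw _ => h w hw le_top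
      rw [← Ortholattice.sup_compl_top (atom v)]
      exact sup_le h₁ h₂
    · exact h v hv le_rfl
    · exact hco hv fun w hw hwv => h w hw (atom_le_coatom.2 hwv)
  exact le_antisymm (hle hx hy fun v hv => (h v hv).1) (hle hy hx fun v hv => (h v hv).2)

theorem isBooleanSubalgebra_ofBlock {e : Finset V} (he : e ∈ T.diagram.blocks) :
    Ortholattice.IsBooleanSubalgebra (ofBlock.{u} T e) := by
  have hsup {x y : Elem.{u} T} (hx : x ∈ ofBlock T e) (hy : y ∈ ofBlock T e) :
      x ⊔ y ∈ ofBlock T e :=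
    compl_mem_ofBlock (inf_mem_ofBlock he (compl_mem_ofBlock hx) (compl_mem_ofBlock hy))
  have hsup_iff {x y : Elem.{u} T} (hx : x ∈ ofBlock T e) (hy : y ∈ ofBlock T e) {v : V}
      (hv : v ∈ e) : atom v ≤ x ⊔ y ↔ atom v ≤ x ∨ atom v ≤ y := by
    rw [← compl_inf, atom_le_compl_iff_of_mem he
      (inf_mem_ofBlock he (compl_mem_ofBlock hx) (compl_mem_ofBlock hy)) hv, le_inf_iff,
      atom_le_compl_iff_of_mem he hx hv, atom_le_compl_iff_of_mem he hy hv]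
    tauto
  refine ⟨Or.inl rfl, Or.inr (Or.inl rfl), fun _ => compl_mem_ofBlock, fun _ hx _ hy => hsup hx hy,
    fun _ hx _ hy => inf_mem_ofBlock he hx hy, fun x hx y hy z hz => ?_⟩
  have hxy := inf_mem_ofBlock he hx hy
  have hxz := inf_mem_ofBlock he hx hz
  refine eq_of_mem_ofBlock he (inf_mem_ofBlock he hx (hsup hy hz)) (hsup hxy hxz) fun v hv => ?_
  rw [le_inf_iff, hsup_iff hy hz hv, hsup_iff hxy hxz hv, le_inf_iff, le_inf_iff]
  tauto

/-- Distributing `v` over `w ⊔ wᶜ = ⊤` gives `v = (v ⊓ w) ⊔ (v ⊓ wᶜ)`, and the first term vanishes.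
-/
theorem perp_of_mem_booleanSubalgebra {B : Set (Elem.{u} T)}
    (hB : Ortholattice.IsBooleanSubalgebra B) {v w : V} (hv : atom v ∈ B) (hw : atom w ∈ B)
    (hvw : v ≠ w) : T.Perp v w := by
  have h := hB.inf_sup_distrib _ hv _ hw _ (hB.compl_mem _ hw)
  rw [Ortholattice.sup_compl_top, inf_top_eq] at h
  rw [← atom_le_coatom, ← compl_atom]
  have h0 : (atom v ⊓ atom w : Elem.{u} T) = ⊥ := by
    rcases (isAtom_atom v).le_iff.1 (inf_le_left : (atom v ⊓ atom w : Elem.{u} T) ≤ atom v)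
      with h' | h'
    · exact h'
    · exact absurd (atom_le_atom.1 (inf_eq_left.1 h')) hvw
  rw [h0, bot_sup_eq] at h
  exact inf_eq_left.1 h.symm

theorem subset_ofBlock {B : Set (Elem.{u} T)} (hB : Ortholattice.IsBooleanSubalgebra B)
    {e : Finset V} (h : ∀ v, atom v ∈ B → v ∈ e) : B ⊆ ofBlock T e := by
  intro x hx
  cases x with
  | bot => exact Or.inl rfl
  | top => exact Or.inr (Or.inl rfl)
  | atom v => exact atom_mem_ofBlock.2 (h v hx)
  | coatom v => exact compl_mem_ofBlock (atom_mem_ofBlock.2 (h v (hB.compl_mem _ hx)))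

/-- The atoms in `B` are pairwise orthogonal; two of them fix a block, which contains every further
one. Coatoms follow by complementation. -/
theorem exists_block_superset {B : Set (Elem.{u} T)} (hB : Ortholattice.IsBooleanSubalgebra B) :
    ∃ e ∈ T.diagram.blocks, B ⊆ ofBlock T e := by
  by_cases h₁ : ∃ v, atom v ∈ B
  · obtain ⟨v, hv⟩ := h₁
    by_cases h₂ : ∃ w, w ≠ v ∧ atom w ∈ B
    · obtain ⟨w, hwv, hw⟩ := h₂
      obtain ⟨-, e, he, hwe, hve⟩ := perp_of_mem_booleanSubalgebra hB hw hv hwv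
      refine ⟨e, he, subset_ofBlock hB fun t ht => ?_⟩
      by_cases htv : t = v
      · rwa [htv]
      by_cases htw : t = w
      · rwa [htw]
      exact mem_of_perp_perp he hwe hve hwv (perp_of_mem_booleanSubalgebra hB ht hw htw)
        (perp_of_mem_booleanSubalgebra hB ht hv htv)
    · push Not at h₂
      obtain ⟨e, he, hve⟩ := T.cover v
      exact ⟨e, he, subset_ofBlock hB fun t ht => by_contra fun hte =>
        h₂ t (fun h => hte (h ▸ hve)) ht⟩
  · push Not at h₁
    obtain ⟨v⟩ := T.diagram.atoms_nonempty
    obtain ⟨e, he, -⟩ := T.cover v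
    exact ⟨e, he, subset_ofBlock hB fun t ht => absurd ht (h₁ t)⟩

theorem isBlock_ofBlock {e : Finset V} (he : e ∈ T.diagram.blocks) :
    Ortholattice.IsBlock (ofBlock.{u} T e) := by
  refine ⟨isBooleanSubalgebra_ofBlock he, fun B hB hle => subset_ofBlock hB fun v hv => ?_⟩
  obtain ⟨a, ha, hav⟩ := Finset.exists_mem_ne (by rw [T.card_three e he]; norm_num) v
  obtain ⟨b, hb, hba⟩ := Finset.exists_mem_ne (by rw [T.card_three e he]; norm_num) a
  by_cases hbv : b = v
  · rwa [← hbv]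
  exact mem_of_perp_perp he hb ha hba
    (perp_of_mem_booleanSubalgebra hB hv (hle (atom_mem_ofBlock.2 hb)) (Ne.symm hbv))
    (perp_of_mem_booleanSubalgebra hB hv (hle (atom_mem_ofBlock.2 ha)) hav.symm)

instance [Finite V] : Finite (Elem.{u} T) :=
  Finite.of_injective _ atoms_injective

theorem represents [Finite V] (T : TripleSystem V) : T.diagram.Represents (Elem.{0} T) := by
  refine ⟨inferInstance, isOrthomodular, ?_⟩
  let f : V → {a : Elem.{0} T // IsAtom a} := fun v => ⟨atom v, isAtom_atom v⟩
  have hf : Function.Bijective f := by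
    refine ⟨fun v w h => atom_injective (congrArg Subtype.val h), fun ⟨a, ha⟩ => ?_⟩
    obtain ⟨v, rfl⟩ := isAtom_iff.1 ha
    exact ⟨v, rfl⟩
  let g : {e : Finset V // e ∈ T.diagram.blocks} →
      {B : Set (Elem.{0} T) // Ortholattice.IsBlock B} :=
    fun e => ⟨ofBlock T e.1, isBlock_ofBlock e.2⟩
  have hg : Function.Bijective g := by
    refine ⟨fun e e' h => Subtype.ext (Finset.ext fun v => ?_), fun ⟨B, hB⟩ => ?_⟩
    · have h' : ofBlock.{0} T e.1 = ofBlock T e'.1 := congrArg Subtype.val h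
      rw [← atom_mem_ofBlock.{0} (T := T), h', atom_mem_ofBlock]
    · obtain ⟨e, he, hBe⟩ := exists_block_superset hB.1
      exact ⟨⟨e, he⟩, Subtype.ext ((hB.2 (isBooleanSubalgebra_ofBlock he) hBe).antisymm hBe)⟩
  exact ⟨Equiv.ofBijective f hf, Equiv.ofBijective g hg, fun v e => atom_mem_ofBlock.symm⟩

end Elem
end TripleSystem

/-! ### The laws as iterated refinement of one operation -/

namespace Ortholattice

variable {L : Type u} [Ortholattice L]

theorem oaEquivAux_le_succ (a : ℕ → L) (k : ℕ) (x y : L) :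
    oaEquivAux a k x y ≤ oaEquivAux a (k + 1) x y :=
  le_sup_left

theorem OALaw.pred {n : ℕ} (hn : 3 < n) (h : OALaw n L) : OALaw (n - 1) L := by
  obtain ⟨k, rfl⟩ := Nat.exists_eq_add_of_lt hn
  intro a
  refine le_trans (inf_le_inf_left _ ?_) (h a)
  rw [oaEquiv, oaEquiv, show 3 + k + 1 - 1 - 3 = k by omega, show 3 + k + 1 - 3 = k + 1 by omega]
  exact oaEquivAux_le_succ a k _ _

/-- The passage from one operation `≡` to the next one, with the new implicit variable `w`. -/
def oaStep (F : L → L → L) (w : L) : L → L → L := fun x y => F x y ⊔ (F x w ⊓ F y w)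

/-- The operation `≡` in three variables. -/
def oaBase (c x y : L) : L := (sasaki x c ⊓ sasaki y c) ⊔ (sasaki xᶜ c ⊓ sasaki yᶜ c)

/-- The orthoarguesian inequality for the operation `F`. -/
def OABound (c : L) (F : L → L → L) : Prop := ∀ x y, sasaki x c ⊓ F x y ≤ sasaki y c

/-- A recursive condition which guarantees that the orthoarguesian inequality persists through `d`
steps from `F`. -/
def OADepth (c : L) : ℕ → (L → L → L) → Prop
  | 0, F => OABound c F
  | d + 1, F => OABound c F ∧
      ∀ w, (∀ x y, F x w ⊓ F y w ≤ F x y) ∨ OADepth c d (oaStep F w)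

theorem OADepth.bound {c : L} {d : ℕ} {F : L → L → L} (h : OADepth c d F) : OABound c F := by
  cases d with
  | zero => exact h
  | succ d => exact h.1

/-- A variable `w` in the first alternative satisfies `oaStep F w = F`, so it uses up none of the
depth; any other `w` uses one level. -/
theorem OADepth.bound_foldl {c : L} (l : List L) {d : ℕ} {F : L → L → L} (hl : l.length ≤ d)
    (h : OADepth c d F) : OABound c (l.foldl oaStep F) := by
  induction l generalizing d F with
  | nil => exact h.bound
  | cons w l ih =>
    cases d with
    | zero => simp at hl
    | succ d =>
      rw [List.length_cons, Nat.succ_le_succ_iff] at hl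
      rw [List.foldl_cons]
      rcases h.2 w with hw | hw
      · have : oaStep F w = F := funext fun x => funext fun y => sup_eq_left.2 (hw x y)
        rw [this]
        exact ih (hl.trans d.le_succ) h
      · exact ih hl hw

theorem oaEquivAux_eq_foldl (a : ℕ → L) (k : ℕ) :
    oaEquivAux a k = ((List.range k).map fun i => a (i + 4)).foldl oaStep (oaBase (a 3)) := by
  induction k with
  | zero => rfl
  | succ k ih =>
    rw [List.range_succ, List.map_append, List.foldl_append, ← ih]
    rfl

theorem oaLaw_of_depth {n : ℕ} (h : ∀ c : L, OADepth c (n - 3) (oaBase c)) : OALaw n L := by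
  intro a
  rw [oaEquiv, oaEquivAux_eq_foldl]
  exact (h (a 3)).bound_foldl _ (by simp) _ _

theorem oaBase_comm (c x y : L) : oaBase c x y = oaBase c y x := by
  rw [oaBase, oaBase, inf_comm (sasaki x c), inf_comm (sasaki xᶜ c)]

theorem oaStep_comm {F : L → L → L} (hF : ∀ x y, F x y = F y x) (w x y : L) :
    oaStep F w x y = oaStep F w y x := by
  rw [oaStep, oaStep, hF x y, inf_comm]

end Ortholattice

/-! ### Tables packed into natural numbers -/

/-- The natural number made from the lanes `f 0, …, f (K - 1)` of width `W`. -/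
def lanes (W : ℕ) (f : ℕ → ℕ) : ℕ → ℕ
  | 0 => 0
  | K + 1 => Nat.add (lanes W f K) (Nat.mul (Nat.pow 2 (Nat.mul W K)) (f K))

/-- The natural number made from `K` lanes of width `W` that all contain `1`. -/
def unitLanes (W K : ℕ) : ℕ :=
  Nat.div (Nat.sub (Nat.pow 2 (Nat.mul W K)) 1) (Nat.sub (Nat.pow 2 W) 1)

theorem lanes_succ (W : ℕ) (f : ℕ → ℕ) (K : ℕ) :
    lanes W f (K + 1) = lanes W f K + 2 ^ (W * K) * f K := rfl

theorem lanes_lt {W : ℕ} {f : ℕ → ℕ} (hf : ∀ i, f i < 2 ^ W) (K : ℕ) :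
    lanes W f K < 2 ^ (W * K) := by
  induction K with
  | zero => simp [lanes]
  | succ K ih =>
    rw [lanes_succ, Nat.mul_succ, pow_add]
    have := hf K
    have : 2 ^ (W * K) * (f K + 1) ≤ 2 ^ (W * K) * 2 ^ W := Nat.mul_le_mul_left _ this
    rw [Nat.mul_succ] at this
    omega

theorem testBit_lanes {W : ℕ} {f : ℕ → ℕ} (hf : ∀ i, f i < 2 ^ W) (K : ℕ) {i t : ℕ} (ht : t < W) :
    (lanes W f K).testBit (W * i + t) = (decide (i < K) && (f i).testBit t) := by
  induction K with
  | zero => simp [lanes]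
  | succ K ih =>
    rw [lanes_succ, Nat.add_comm, Nat.testBit_two_pow_mul_add _ (lanes_lt hf K)]
    rcases lt_trichotomy i K with h | rfl | h
    · have h' : W * (i + 1) ≤ W * K := Nat.mul_le_mul_left _ h
      rw [Nat.mul_succ] at h'
      rw [if_pos (by omega), ih]
      simp [h, h.trans K.lt_succ_self]
    · rw [if_neg (by omega)]
      simp
    · have h' : W * (K + 1) ≤ W * i := Nat.mul_le_mul_left _ h
      rw [Nat.mul_succ] at h'
      rw [if_neg (by omega), Nat.testBit_lt_two_pow]
      · simp [show ¬ i < K + 1 by omega]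
      · exact (hf K).trans_le (Nat.pow_le_pow_right (by norm_num) (by omega))

theorem lanes_mul (W : ℕ) (f : ℕ → ℕ) (K m : ℕ) :
    lanes W f K * m = lanes W (fun i => f i * m) K := by
  induction K with
  | zero => simp [lanes]
  | succ K ih => rw [lanes_succ, lanes_succ, add_mul, ih, mul_assoc]

/-- The geometric sum in powers of `2 ^ W`. Multiplication by this number copies an entry of less
than `W + 1` bits into every lane, without carries. -/
theorem unitLanes_eq {W : ℕ} (hW : 0 < W) (K : ℕ) : unitLanes W K = lanes W (fun _ => 1) K := by
  have h1 : 1 < 2 ^ W := Nat.one_lt_two_pow hW.ne'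
  have h : lanes W (fun _ => 1) K * (2 ^ W - 1) + 1 = 2 ^ (W * K) := by
    induction K with
    | zero => simp [lanes]
    | succ K ih =>
      obtain ⟨m, hm⟩ : ∃ m, 2 ^ W = m + 1 := ⟨2 ^ W - 1, by omega⟩
      rw [hm, Nat.add_sub_cancel] at ih
      rw [lanes_succ, show W * (K + 1) = W * K + W from rfl, pow_add, ← ih, hm, Nat.add_sub_cancel]
      ring
  change (2 ^ (W * K) - 1) / (2 ^ W - 1) = _
  rw [← h, Nat.add_sub_cancel, Nat.mul_div_cancel _ (by omega)]

theorem mul_unitLanes {W : ℕ} (hW : 0 < W) (K m : ℕ) :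
    m * unitLanes W K = lanes W (fun _ => m) K := by
  rw [unitLanes_eq hW, mul_comm, lanes_mul]
  simp

theorem testBit_mul_unitLanes {W m : ℕ} (hm : m < 2 ^ W) (K : ℕ) {i t : ℕ} (hi : i < K)
    (ht : t < W) : (m * unitLanes W K).testBit (W * i + t) = m.testBit t := by
  rw [mul_unitLanes (by omega), testBit_lanes (fun _ => hm) K ht]
  simp [hi]

/-- A row is a lane of width `W * D`. Filling each row with its own entry gives the table of a
function of `x` alone; repeating one row, as in `testBit_mul_unitLanes_row`, gives a function of `y`
alone. -/
theorem testBit_lanes_mul_unitLanes {W D : ℕ} {f : ℕ → ℕ} (hf : ∀ i, f i < 2 ^ W) {x y t : ℕ}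
    (hx : x < D) (hy : y < D) (ht : t < W) :
    (lanes (W * D) f D * unitLanes W D).testBit (W * (D * x + y) + t) = (f x).testBit t := by
  have hlt : W * y + t < W * D := by
    have : W * (y + 1) ≤ W * D := Nat.mul_le_mul_left _ hy
    rw [Nat.mul_succ] at this
    omega
  rw [show W * (D * x + y) + t = W * D * x + (W * y + t) by ring, lanes_mul,
    testBit_lanes (fun i => ?_) D hlt, testBit_mul_unitLanes (hf x) D hy ht]
  · simp [hx]
  · rw [mul_unitLanes (by omega)]
    exact lanes_lt (fun _ => hf i) D

theorem testBit_mul_unitLanes_row {W D R : ℕ} (hR : R < 2 ^ (W * D)) {x y t : ℕ}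
    (hx : x < D) (hy : y < D) (ht : t < W) :
    (R * unitLanes (W * D) D).testBit (W * (D * x + y) + t) = R.testBit (W * y + t) := by
  have hlt : W * y + t < W * D := by
    have : W * (y + 1) ≤ W * D := Nat.mul_le_mul_left _ hy
    rw [Nat.mul_succ] at this
    omega
  rw [show W * (D * x + y) + t = W * D * x + (W * y + t) by ring, testBit_mul_unitLanes hR D hx hlt]

theorem eq_of_testBit_lanes {W : ℕ} (hW : 0 < W) {X Y : ℕ}
    (h : ∀ i t, t < W → X.testBit (W * i + t) = Y.testBit (W * i + t)) : X = Y := by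
  refine Nat.eq_of_testBit_eq fun j => ?_
  rw [← Nat.div_add_mod j W]
  exact h _ _ (Nat.mod_lt _ hW)

/-- The entry `(x, w)` of every row `x` is copied to the whole row. -/
def colLanes (W D w B : ℕ) : ℕ :=
  Nat.mul (Nat.land (Nat.shiftRight B (Nat.mul W w))
    (Nat.mul (Nat.sub (Nat.pow 2 W) 1) (unitLanes (Nat.mul W D) D))) (unitLanes W D)

/-- The row `w` is copied to all rows. -/
def rowLanes (W D w B : ℕ) : ℕ :=
  Nat.mul (Nat.mod (Nat.shiftRight B (Nat.mul (Nat.mul W D) w)) (Nat.pow 2 (Nat.mul W D)))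
    (unitLanes (Nat.mul W D) D)

/-- The shift moves entry `(x, w)` to the front of row `x`, the mask deletes the rest of the row,
and the product spreads the entry over the row. -/
theorem testBit_colLanes {W D w B x y t : ℕ} (hx : x < D) (hy : y < D) (ht : t < W) :
    (colLanes W D w B).testBit (W * (D * x + y) + t) = B.testBit (W * (D * x + w) + t) := by
  have hW : 0 < W := by omega
  have hD : 0 < D := by omega
  have hWD : W ≤ W * D := Nat.le_mul_of_pos_right W hD
  have key : (B >>> (W * w)) &&& ((2 ^ W - 1) * unitLanes (W * D) D) =
      lanes (W * D) (fun x => (B >>> (W * (D * x + w))) % 2 ^ W) D := by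
    refine eq_of_testBit_lanes (Nat.mul_pos hW hD) fun i s hs => ?_
    have h1 : ∀ m < 2 ^ W, m < 2 ^ (W * D) := fun m hm =>
      hm.trans_le (Nat.pow_le_pow_right (by norm_num) hWD)
    rw [testBit_lanes (fun i => h1 _ (Nat.mod_lt _ (by positivity))) D hs, Nat.testBit_and,
      mul_unitLanes (Nat.mul_pos hW hD),
      testBit_lanes (fun i => h1 _ (Nat.sub_lt (by positivity) (by norm_num))) D hs,
      Nat.testBit_shiftRight, Nat.testBit_mod_two_pow, Nat.testBit_two_pow_sub_one,
      Nat.testBit_shiftRight,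
      show W * w + (W * D * i + s) = W * (D * i + w) + s by ring]
    cases decide (i < D) <;> cases decide (s < W) <;> simp
  change (((B >>> (W * w)) &&& ((2 ^ W - 1) * unitLanes (W * D) D)) * unitLanes W D).testBit _ = _
  rw [key, testBit_lanes_mul_unitLanes (fun i => Nat.mod_lt _ (by positivity)) hx hy ht,
    Nat.testBit_mod_two_pow, Nat.testBit_shiftRight]
  simp [ht]

theorem testBit_rowLanes {W D w B x y t : ℕ} (hx : x < D) (hy : y < D) (ht : t < W) :
    (rowLanes W D w B).testBit (W * (D * x + y) + t) = B.testBit (W * (D * w + y) + t) := by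
  have hlt : W * y + t < W * D := by
    have : W * (y + 1) ≤ W * D := Nat.mul_le_mul_left _ hy
    rw [Nat.mul_succ] at this
    omega
  change (B >>> (W * D * w) % 2 ^ (W * D) * unitLanes (W * D) D).testBit _ = _
  rw [testBit_mul_unitLanes_row (Nat.mod_lt _ (by positivity)) hx hy ht, Nat.testBit_mod_two_pow,
    Nat.testBit_shiftRight, show W * D * w + (W * y + t) = W * (D * w + y) + t by ring]
  simp [hlt]

/-- The lanes of atoms that are not orthogonal to some atom `< s` of the lanes of `X`, where `nb a`
is the set of atoms orthogonal to `a`. -/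
def nonPerpLanes (W ones : ℕ) (nb : ℕ → ℕ) (X : ℕ) : ℕ → ℕ
  | 0 => 0
  | s + 1 => Nat.lor (nonPerpLanes W ones nb X s)
      (Nat.mul (Nat.land (Nat.shiftRight X s) ones) (Nat.sub (Nat.sub (Nat.pow 2 W) 1) (nb s)))

/-- The orthocomplement in every lane. -/
def lanesCompl (W ones full : ℕ) (nb : ℕ → ℕ) (X : ℕ) : ℕ := Nat.xor full (nonPerpLanes W ones nb X W)

theorem testBit_nonPerpLanes {W K : ℕ} {nb : ℕ → ℕ} (X : ℕ) {s₀ i t : ℕ} (hs₀ : s₀ ≤ W)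
    (hi : i < K) (ht : t < W) (hnb : ∀ s < W, nb s < 2 ^ W) :
    (nonPerpLanes W (unitLanes W K) nb X s₀).testBit (W * i + t) = true ↔
      ∃ s < s₀, X.testBit (W * i + s) = true ∧ ¬ (nb s).testBit t = true := by
  induction s₀ with
  | zero => simp [nonPerpLanes]
  | succ s ih =>
    have hW : 0 < W := by omega
    -- Bit `s` of every lane moves to bit `0`, so the product with a mask writes that mask exactly
    -- into the lanes whose element has the atom `s` below it.
    have key : (X >>> s) &&& unitLanes W K =
        lanes W (fun i => (X.testBit (W * i + s)).toNat) K := by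
      refine eq_of_testBit_lanes hW fun j r hr => ?_
      rw [unitLanes_eq hW, Nat.testBit_and, testBit_lanes (fun _ => Nat.one_lt_two_pow hW.ne') K hr,
        testBit_lanes (fun _ => (Bool.toNat_lt _).trans_le (Nat.one_lt_two_pow hW.ne')) K hr,
        Nat.testBit_shiftRight, Nat.add_comm s]
      rcases Nat.eq_zero_or_pos r with rfl | hr'
      · cases X.testBit (W * j + s) <;> simp
      · rw [Nat.testBit_lt_two_pow (Nat.one_lt_two_pow hr'.ne'), Nat.testBit_lt_two_pow
          ((Bool.toNat_lt _).trans_le (Nat.one_lt_two_pow hr'.ne'))]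
        simp
    have hlt : 2 ^ W - 1 - nb s < 2 ^ W := by
      have : 0 < 2 ^ W := by positivity
      omega
    have hc : (2 ^ W - 1 - nb s).testBit t = !(nb s).testBit t := by
      rw [Nat.sub_sub, Nat.add_comm 1, Nat.testBit_two_pow_sub_succ (hnb s (by omega))]
      simp [ht]
    change ((nonPerpLanes W (unitLanes W K) nb X s) |||
      ((X >>> s) &&& unitLanes W K) * (2 ^ W - 1 - nb s)).testBit _ = true ↔ _
    rw [Nat.testBit_or, Bool.or_eq_true, ih (by omega), key, lanes_mul, testBit_lanes (fun j => ?_) K ht]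
    · rw [decide_eq_true hi, Bool.true_and]
      have hb : ((X.testBit (W * i + s)).toNat * (2 ^ W - 1 - nb s)).testBit t = true ↔
          X.testBit (W * i + s) = true ∧ ¬ (nb s).testBit t = true := by
        cases X.testBit (W * i + s) <;> simp [hc]
      rw [hb]
      constructor
      · rintro (⟨r, hr, h⟩ | h)
        · exact ⟨r, by omega, h⟩
        · exact ⟨s, by omega, h⟩
      · rintro ⟨r, hr, h⟩
        rcases Nat.lt_succ_iff_lt_or_eq.1 hr with hr | rfl
        · exact Or.inl ⟨r, hr, h⟩
        · exact Or.inr h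
    · cases X.testBit (W * j + s)
      · simp
      · simpa using hlt

theorem testBit_lanesCompl {W K : ℕ} {nb : ℕ → ℕ} (X : ℕ) {i t : ℕ}
    (hi : i < K) (ht : t < W) (hnb : ∀ s < W, nb s < 2 ^ W) :
    (lanesCompl W (unitLanes W K) (2 ^ (W * K) - 1) nb X).testBit (W * i + t) = true ↔
      ∀ s < W, X.testBit (W * i + s) = true → (nb s).testBit t = true := by
  have hlt : W * i + t < W * K := by
    have : W * (i + 1) ≤ W * K := Nat.mul_le_mul_left _ hi
    rw [Nat.mul_succ] at this
    omega
  change ((2 ^ (W * K) - 1) ^^^ nonPerpLanes W (unitLanes W K) nb X W).testBit _ = true ↔ _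
  have h := testBit_nonPerpLanes (nb := nb) X le_rfl hi ht hnb
  rw [Nat.testBit_xor, Nat.testBit_two_pow_sub_one, decide_eq_true hlt, Bool.true_xor,
    Bool.not_eq_true', ← Bool.not_eq_true, h]
  push Not
  rfl

/-- The join in every lane. -/
def lanesSup (W ones full : ℕ) (nb : ℕ → ℕ) (X Y : ℕ) : ℕ :=
  lanesCompl W ones full nb (lanesCompl W ones full nb (Nat.lor X Y))

/-- The implication in every lane. -/
def lanesSasaki (W ones full : ℕ) (nb : ℕ → ℕ) (X Y : ℕ) : ℕ :=
  lanesSup W ones full nb (lanesCompl W ones full nb X) (Nat.land X Y)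

/-- The set of atoms below the element with index `i`: the elements are listed as atoms, coatoms,
bottom, top. -/
def elemMask (n : ℕ) (nb : ℕ → ℕ) (i : ℕ) : ℕ :=
  cond (Nat.ble n i) (cond (Nat.ble (Nat.add n n) i)
    (cond (Nat.beq i (Nat.add n n)) 0 (Nat.sub (Nat.pow 2 n) 1)) (nb (Nat.sub i n))) (Nat.pow 2 i)

/-- Whether `p` is true below a bound. -/
def allBelow (p : ℕ → Bool) : ℕ → Bool
  | 0 => true
  | k + 1 => cond (p k) (allBelow p k) false

/-- Whether the lanes of `X` are contained in those of `Y`. -/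
def lanesLE (X Y : ℕ) : Bool := Nat.beq (Nat.land X Y) X

/-- The test of `Ortholattice.OADepth`, for an operation given by its table `B`. -/
def oaDepthTest (W D ones full : ℕ) (nb : ℕ → ℕ) (PX PY : ℕ) : ℕ → ℕ → Bool
  | 0, B => lanesLE (Nat.land PX B) PY
  | d + 1, B => cond (lanesLE (Nat.land PX B) PY)
      (allBelow (fun w =>
        cond (lanesLE (Nat.land (colLanes W D w B) (rowLanes W D w B)) B) true
          (oaDepthTest W D ones full nb PX PY d
            (lanesSup W ones full nb B (Nat.land (colLanes W D w B) (rowLanes W D w B))))) D) false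

/-- The test for the variable `c`, given the tables `XX`, `YY`, `C` of the first variable, the second
variable, and `c`. -/
def oaTableTest (W D ones full XX YY : ℕ) (nb : ℕ → ℕ) (d : ℕ) (C : ℕ) : Bool :=
  oaDepthTest W D ones full nb (lanesSasaki W ones full nb XX C) (lanesSasaki W ones full nb YY C) d
    (lanesSup W ones full nb
      (Nat.land (lanesSasaki W ones full nb XX C) (lanesSasaki W ones full nb YY C))
      (Nat.land (lanesSasaki W ones full nb (lanesCompl W ones full nb XX) C)
        (lanesSasaki W ones full nb (lanesCompl W ones full nb YY) C)))

/-- The test for the variable with index `c`. -/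
def oaTest (n D : ℕ) (nb : ℕ → ℕ) (d c : ℕ) : Bool :=
  oaTableTest n D (unitLanes n (Nat.mul D D)) (Nat.sub (Nat.pow 2 (Nat.mul n (Nat.mul D D))) 1)
    (Nat.mul (lanes (Nat.mul n D) (elemMask n nb) D) (unitLanes n D))
    (Nat.mul (lanes n (elemMask n nb) D) (unitLanes (Nat.mul n D) D)) nb d
    (Nat.mul (elemMask n nb c) (unitLanes n (Nat.mul D D)))

theorem allBelow_eq_true {p : ℕ → Bool} {k : ℕ} (h : allBelow p k = true) :
    ∀ i < k, p i = true := by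
  induction k with
  | zero => simp
  | succ k ih =>
    rw [allBelow] at h
    intro i hi
    cases hp : p k with
    | false => simp [hp] at h
    | true =>
      rw [hp, cond_true] at h
      rcases Nat.lt_succ_iff_lt_or_eq.1 hi with hi | rfl
      · exact ih h i hi
      · exact hp

theorem testBit_of_lanesLE {X Y : ℕ} (h : lanesLE X Y = true) {j : ℕ} (hj : X.testBit j = true) :
    Y.testBit j = true := by
  have h' : X &&& Y = X := Nat.eq_of_beq_eq_true h
  rw [← h', Nat.testBit_and, Bool.and_eq_true] at hj
  exact hj.2

/-! ### Correctness of the table test -/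

namespace TripleSystem

variable {n : ℕ} {T : TripleSystem (Fin n)}

/-- The element with index `i`. -/
def elemAt (T : TripleSystem (Fin n)) (i : ℕ) : Elem.{u} T :=
  if h : i < n then .atom ⟨i, h⟩
  else if h : i - n < n then .coatom ⟨i - n, h⟩
  else if i = n + n then .bot else .top

theorem exists_elemAt (x : Elem.{u} T) : ∃ i < 2 * n + 2, elemAt T i = x := by
  cases x with
  | bot => exact ⟨n + n, by omega, by simp [elemAt]⟩
  | top => exact ⟨n + n + 1, by omega, by simp [elemAt, show ¬ n + n + 1 < n by omega,
      show ¬ n + n + 1 - n < n by omega]⟩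
  | atom v => exact ⟨v, by omega, by simp [elemAt]⟩
  | coatom v => exact ⟨n + v, by omega, by simp [elemAt]⟩

/-- The function `nb` lists the sets of atoms orthogonal to the atoms of `T`. -/
structure IsNeighborMask (T : TripleSystem (Fin n)) (nb : ℕ → ℕ) : Prop where
  lt (s : ℕ) : s < n → nb s < 2 ^ n
  testBit_iff (s t : Fin n) : (nb s).testBit t = true ↔ T.Perp s t

variable {nb : ℕ → ℕ}

theorem elemMask_lt (h : IsNeighborMask T nb) (i : ℕ) : elemMask n nb i < 2 ^ n := by
  have h0 : 0 < 2 ^ n := by positivity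
  rw [elemMask]
  cases h₁ : Nat.ble n i with
  | false =>
    have h₁' : ¬ n ≤ i := fun h => by simp [Nat.ble_eq_true_of_le h] at h₁
    exact Nat.pow_lt_pow_right (by norm_num) (by omega)
  | true =>
    cases h₂ : Nat.ble (Nat.add n n) i with
    | false =>
      have h₁' : n ≤ i := Nat.le_of_ble_eq_true h₁
      have h₂' : ¬ n + n ≤ i := fun h => by
        rw [show Nat.add n n = n + n from rfl, Nat.ble_eq_true_of_le h] at h₂
        exact absurd h₂ (by simp)
      exact h.lt _ (show i - n < n by omega)
    | true =>
      cases Nat.beq i (Nat.add n n) with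
      | false => exact Nat.sub_lt h0 (by norm_num)
      | true => exact h0

theorem testBit_elemMask (h : IsNeighborMask T nb) (i : ℕ) (t : Fin n) :
    (elemMask n nb i).testBit t = true ↔ Elem.atom t ≤ (elemAt.{u} T i) := by
  rw [elemMask, elemAt]
  cases h₁ : Nat.ble n i with
  | false =>
    have h₁' : i < n := by
      by_contra h'
      simp [Nat.ble_eq_true_of_le (Nat.le_of_not_lt h')] at h₁
    rw [dif_pos h₁', Elem.atom_le_atom, cond_false, show Nat.pow 2 i = 2 ^ i from rfl,
      Nat.testBit_two_pow, decide_eq_true_iff, Fin.ext_iff, eq_comm]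
  | true =>
    have h₁' : n ≤ i := Nat.le_of_ble_eq_true h₁
    rw [dif_neg (by omega), cond_true]
    cases h₂ : Nat.ble (Nat.add n n) i with
    | false =>
      have h₂' : i - n < n := by
        by_contra h'
        rw [show Nat.add n n = n + n from rfl,
          Nat.ble_eq_true_of_le (show n + n ≤ i by omega)] at h₂
        exact absurd h₂ (by simp)
      rw [dif_pos h₂', Elem.atom_le_coatom, cond_false, perp_comm]
      exact h.testBit_iff ⟨i - n, h₂'⟩ t
    | true =>
      have h₂' : n + n ≤ i := Nat.le_of_ble_eq_true h₂
      rw [dif_neg (by omega), cond_true]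
      cases h₃ : Nat.beq i (Nat.add n n) with
      | false =>
        have h₃' : i ≠ n + n := fun h' => by
          rw [show Nat.add n n = n + n from rfl, h', Nat.beq_refl] at h₃
          exact absurd h₃ (by simp)
        rw [if_neg h₃', cond_false]
        refine iff_of_true ?_ (show Elem.atom t ≤ (⊤ : Elem.{u} T) from le_top)
        change (2 ^ n - 1).testBit t = true
        rw [Nat.testBit_two_pow_sub_one]
        simp
      | true =>
        rw [if_pos (show i = n + n from Nat.eq_of_beq_eq_true h₃), cond_true]
        exact iff_of_false (by simp) (Elem.atom_not_le_bot t)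

/-- The lanes of `X` represent the elements `f 0, …, f (K - 1)`. -/
def IsTable (T : TripleSystem (Fin n)) (K X : ℕ) (f : ℕ → Elem.{u} T) : Prop :=
  ∀ i < K, ∀ t : Fin n, X.testBit (n * i + t) = true ↔ Elem.atom t ≤ f i

variable {K X Y : ℕ} {f g : ℕ → Elem.{u} T}

theorem IsTable.land (hX : IsTable T K X f) (hY : IsTable T K Y g) :
    IsTable T K (Nat.land X Y) (fun i => f i ⊓ g i) := fun i hi t => by
  change (X &&& Y).testBit _ = true ↔ _
  rw [Nat.testBit_and, Bool.and_eq_true, hX i hi, hY i hi, le_inf_iff]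

theorem IsTable.compl (h : IsNeighborMask T nb) (hX : IsTable T K X f) :
    IsTable T K (lanesCompl n (unitLanes n K) (2 ^ (n * K) - 1) nb X) (fun i => (f i)ᶜ) :=
  fun i hi t => by
    rw [testBit_lanesCompl X hi t.2 h.lt, Elem.atom_le_compl_iff]
    exact ⟨fun h' s hs => (h.testBit_iff s t).1 (h' s s.2 ((hX i hi s).2 hs)),
      fun h' s hs hX' => (h.testBit_iff ⟨s, hs⟩ t).2 (h' ⟨s, hs⟩ ((hX i hi ⟨s, hs⟩).1 hX'))⟩

/-- The polar of a union is the meet of the polars, so the double polar of the union is the join,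
although the union itself need not represent an element. -/
theorem IsTable.sup (h : IsNeighborMask T nb) (hX : IsTable T K X f) (hY : IsTable T K Y g) :
    IsTable T K (lanesSup n (unitLanes n K) (2 ^ (n * K) - 1) nb X Y) (fun i => f i ⊔ g i) := by
  have : IsTable T K (lanesCompl n (unitLanes n K) (2 ^ (n * K) - 1) nb (Nat.lor X Y))
      (fun i => (f i)ᶜ ⊓ (g i)ᶜ) := fun i hi t => by
    rw [testBit_lanesCompl _ hi t.2 h.lt, le_inf_iff, Elem.atom_le_compl_iff,
      Elem.atom_le_compl_iff]
    change (∀ s < n, (X ||| Y).testBit _ = true → _) ↔ _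
    simp only [Nat.testBit_or, Bool.or_eq_true]
    exact ⟨fun h' => ⟨fun s hs => (h.testBit_iff s t).1 (h' s s.2 (Or.inl ((hX i hi s).2 hs))),
        fun s hs => (h.testBit_iff s t).1 (h' s s.2 (Or.inr ((hY i hi s).2 hs)))⟩,
      fun h' s hs hXY => (h.testBit_iff ⟨s, hs⟩ t).2 (hXY.elim
        (fun hX' => h'.1 ⟨s, hs⟩ ((hX i hi ⟨s, hs⟩).1 hX'))
        (fun hY' => h'.2 ⟨s, hs⟩ ((hY i hi ⟨s, hs⟩).1 hY')))⟩
  exact this.compl h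

theorem IsTable.sasaki (h : IsNeighborMask T nb) (hX : IsTable T K X f) (hY : IsTable T K Y g) :
    IsTable T K (lanesSasaki n (unitLanes n K) (2 ^ (n * K) - 1) nb X Y)
      (fun i => Ortholattice.sasaki (f i) (g i)) :=
  (hX.compl h).sup h (hX.land hY)

theorem IsTable.le (hX : IsTable T K X f) (hY : IsTable T K Y g) (h : lanesLE X Y = true) {i : ℕ}
    (hi : i < K) : f i ≤ g i :=
  Elem.le_iff.2 fun t ht => (hY i hi t).1 (testBit_of_lanesLE h ((hX i hi t).2 ht))

/-- The lanes of `X` represent the values of the operation `F`. -/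
abbrev IsOpTable (T : TripleSystem (Fin n)) (D X : ℕ) (F : Elem.{u} T → Elem.{u} T → Elem.{u} T) : Prop :=
  IsTable T (D * D) X (fun i => F (elemAt T (i / D)) (elemAt T (i % D)))

section

variable {D B : ℕ} {F : Elem.{u} T → Elem.{u} T → Elem.{u} T}

theorem isOpTable_iff : IsOpTable T D B F ↔ ∀ x < D, ∀ y < D, ∀ t : Fin n,
    B.testBit (n * (D * x + y) + t) = true ↔ Elem.atom t ≤ F (elemAt T x) (elemAt T y) := by
  constructor
  · intro h x hx y hy t
    have hi : D * x + y < D * D := by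
      have : D * (x + 1) ≤ D * D := Nat.mul_le_mul_left _ hx
      rw [Nat.mul_succ] at this
      omega
    have := h _ hi t
    dsimp only at this
    rwa [Nat.mul_add_div (Nat.zero_lt_of_lt hy), Nat.div_eq_of_lt hy, Nat.add_zero, Nat.mul_add_mod,
      Nat.mod_eq_of_lt hy] at this
  · intro h i hi t
    have hD : 0 < D := Nat.pos_of_ne_zero fun h0 => by simp [h0] at hi
    have := h (i / D) (Nat.div_lt_of_lt_mul hi) (i % D) (Nat.mod_lt _ hD) t
    rwa [Nat.div_add_mod] at this

/-- The second factor is read from row `w`, which holds `F w y`; symmetry of `F` identifies it with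
`F y w`. -/
theorem IsOpTable.step (h : IsOpTable T D B F) (hF : ∀ x y, F x y = F y x) {w : ℕ} (hw : w < D) :
    IsOpTable T D (Nat.land (colLanes n D w B) (rowLanes n D w B))
      (fun x y => F x (elemAt T w) ⊓ F y (elemAt T w)) := by
  rw [isOpTable_iff] at h ⊢
  intro x hx y hy t
  change (colLanes n D w B &&& rowLanes n D w B).testBit _ = true ↔ _
  rw [Nat.testBit_and, testBit_colLanes hx hy t.2, testBit_rowLanes hx hy t.2, Bool.and_eq_true,
    h x hx w hw, h w hw y hy, hF (elemAt T w), le_inf_iff]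

theorem IsOpTable.le {X Y : ℕ} {F G : Elem.{u} T → Elem.{u} T → Elem.{u} T}
    (hX : IsOpTable T (2 * n + 2) X F) (hY : IsOpTable T (2 * n + 2) Y G)
    (h : lanesLE X Y = true) (x y : Elem.{u} T) : F x y ≤ G x y := by
  obtain ⟨i, hi, rfl⟩ := exists_elemAt x
  obtain ⟨j, hj, rfl⟩ := exists_elemAt y
  rw [isOpTable_iff] at hX hY
  exact Elem.le_iff.2 fun t ht =>
    (hY i hi j hj t).1 (testBit_of_lanesLE h ((hX i hi j hj t).2 ht))

end

/-- The `2 * n + 2` indices exhaust the lattice, so one inclusion of tables is an inequality for all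
`x` and `y`, and the test follows `OADepth` clause by clause. -/
theorem oaDepth_of_test (h : IsNeighborMask T nb) {D : ℕ} (hD : D = 2 * n + 2) {c : Elem.{u} T}
    {PX PY : ℕ} (hPX : IsOpTable T D PX fun x _ => Ortholattice.sasaki x c)
    (hPY : IsOpTable T D PY fun _ y => Ortholattice.sasaki y c) (d : ℕ) {B : ℕ}
    {F : Elem.{u} T → Elem.{u} T → Elem.{u} T} (hF : ∀ x y, F x y = F y x) (hB : IsOpTable T D B F)
    (ht : oaDepthTest n D (unitLanes n (D * D)) (2 ^ (n * (D * D)) - 1) nb PX PY d B = true) :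
    Ortholattice.OADepth c d F := by
  subst hD
  have hbound (h' : lanesLE (Nat.land PX B) PY = true) : Ortholattice.OABound c F :=
    IsOpTable.le (hPX.land hB) hPY h'
  induction d generalizing B F with
  | zero => exact hbound ht
  | succ d ih =>
    rw [oaDepthTest] at ht
    cases h₁ : lanesLE (Nat.land PX B) PY with
    | false =>
      rw [h₁] at ht
      exact absurd ht (by simp)
    | true =>
      rw [h₁, cond_true] at ht
      refine ⟨hbound h₁, fun w => ?_⟩
      obtain ⟨i, hi, rfl⟩ := exists_elemAt w
      have hi' := allBelow_eq_true ht i hi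
      have hs := hB.step hF hi
      cases h₂ : lanesLE (Nat.land (colLanes n (2 * n + 2) i B) (rowLanes n (2 * n + 2) i B)) B with
      | true => exact Or.inl (IsOpTable.le hs hB h₂)
      | false =>
        rw [h₂, cond_false] at hi'
        have hB' := IsTable.sup h hB hs
        exact Or.inr (ih (Ortholattice.oaStep_comm hF _) hB' hi'
          (fun h' => IsOpTable.le (hPX.land hB') hPY h'))

theorem oaLaw_of_test (h : IsNeighborMask T nb) {D k : ℕ} (hD : D = 2 * n + 2)
    (ht : allBelow (oaTest n D nb (k - 3)) D = true) : Ortholattice.OALaw k (Elem.{u} T) := by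
  refine Ortholattice.oaLaw_of_depth fun c => ?_
  obtain ⟨i, hi, rfl⟩ := exists_elemAt c
  have hi' := allBelow_eq_true ht i (by omega)
  have hX : IsOpTable T D (lanes (n * D) (elemMask n nb) D * unitLanes n D)
      (fun (x _ : Elem.{u} T) => x) := isOpTable_iff.2 fun x hx y hy t => by
    rw [testBit_lanes_mul_unitLanes (elemMask_lt h) hx hy t.2]
    exact testBit_elemMask h x t
  have hY : IsOpTable T D (lanes n (elemMask n nb) D * unitLanes (n * D) D)
      (fun (_ y : Elem.{u} T) => y) := isOpTable_iff.2 fun x hx y hy t => by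
    rw [testBit_mul_unitLanes_row (lanes_lt (elemMask_lt h) D) hx hy t.2,
      testBit_lanes (elemMask_lt h) D t.2, decide_eq_true hy, Bool.true_and]
    exact testBit_elemMask h y t
  have hC : IsOpTable T D (elemMask n nb i * unitLanes n (D * D))
      (fun (_ _ : Elem.{u} T) => elemAt.{u} T i) := fun j hj t => by
    rw [testBit_mul_unitLanes (elemMask_lt h i) _ hj t.2]
    exact testBit_elemMask h i t
  have hPX := hX.sasaki h hC
  have hPY := hY.sasaki h hC
  exact oaDepth_of_test h hD hPX hPY _ (Ortholattice.oaBase_comm _)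
    (IsTable.sup h (hPX.land hPY)
      (((hX.compl h).sasaki h hC).land ((hY.compl h).sasaki h hC))) hi'

end TripleSystem

/-! ### Testing one assignment, and triple systems from lists -/

/-- The operation `≡` for elements that are given by their sets of atoms. -/
def oaEquivMask (n : ℕ) (nb : ℕ → ℕ) (a : ℕ → ℕ) : ℕ → ℕ → ℕ → ℕ
  | 0, x, y =>
      lanesSup n (unitLanes n 1) (2 ^ (n * 1) - 1) nb
        (Nat.land (lanesSasaki n (unitLanes n 1) (2 ^ (n * 1) - 1) nb x (a 3))
          (lanesSasaki n (unitLanes n 1) (2 ^ (n * 1) - 1) nb y (a 3)))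
        (Nat.land (lanesSasaki n (unitLanes n 1) (2 ^ (n * 1) - 1) nb
            (lanesCompl n (unitLanes n 1) (2 ^ (n * 1) - 1) nb x) (a 3))
          (lanesSasaki n (unitLanes n 1) (2 ^ (n * 1) - 1) nb
            (lanesCompl n (unitLanes n 1) (2 ^ (n * 1) - 1) nb y) (a 3)))
  | k + 1, x, y =>
      lanesSup n (unitLanes n 1) (2 ^ (n * 1) - 1) nb (oaEquivMask n nb a k x y)
        (Nat.land (oaEquivMask n nb a k x (a (k + 4))) (oaEquivMask n nb a k y (a (k + 4))))

/-- Whether the atom `t` violates the `k`OA law for the variables with indices `v 1, …, v k`. -/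
def oaViolationTest (n : ℕ) (nb : ℕ → ℕ) (k : ℕ) (v : ℕ → ℕ) (t : ℕ) : Bool :=
  (Nat.land
      (lanesSasaki n (unitLanes n 1) (2 ^ (n * 1) - 1) nb (elemMask n nb (v 1)) (elemMask n nb (v 3)))
      (oaEquivMask n nb (fun i => elemMask n nb (v i)) (k - 3) (elemMask n nb (v 1))
        (elemMask n nb (v 2)))).testBit t &&
    !(lanesSasaki n (unitLanes n 1) (2 ^ (n * 1) - 1) nb (elemMask n nb (v 2))
        (elemMask n nb (v 3))).testBit t

/-- The atoms of a triple other than `v`, if `v` belongs to the triple. -/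
def tripleMask {n : ℕ} (t : Fin n × Fin n × Fin n) (v : ℕ) : ℕ :=
  cond (Nat.beq v t.1) (Nat.lor (2 ^ t.2.1.val) (2 ^ t.2.2.val))
    (cond (Nat.beq v t.2.1) (Nat.lor (2 ^ t.1.val) (2 ^ t.2.2.val))
      (cond (Nat.beq v t.2.2) (Nat.lor (2 ^ t.1.val) (2 ^ t.2.1.val)) 0))

/-- The atoms that share a triple with `v`. -/
def neighborMask {n : ℕ} (l : List (Fin n × Fin n × Fin n)) (v : ℕ) : ℕ :=
  l.foldr (fun t m => Nat.lor (tripleMask t v) m) 0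

/-- The blocks given by a list of triples. -/
def tripleBlocks {n : ℕ} (l : List (Fin n × Fin n × Fin n)) : Finset (Finset (Fin n)) :=
  (l.map fun t => ({t.1, t.2.1, t.2.2} : Finset (Fin n))).toFinset

section

variable {n : ℕ}

theorem mem_tripleBlocks {l : List (Fin n × Fin n × Fin n)} {e : Finset (Fin n)} :
    e ∈ tripleBlocks l ↔ ∃ t ∈ l, {t.1, t.2.1, t.2.2} = e := by
  simp [tripleBlocks]

theorem testBit_tripleMask {t : Fin n × Fin n × Fin n}
    (ht : t.1 ≠ t.2.1 ∧ t.1 ≠ t.2.2 ∧ t.2.1 ≠ t.2.2) (v w : Fin n) :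
    (tripleMask t v).testBit w = true ↔
      v ≠ w ∧ v ∈ ({t.1, t.2.1, t.2.2} : Finset (Fin n)) ∧
        w ∈ ({t.1, t.2.1, t.2.2} : Finset (Fin n)) := by
  obtain ⟨a, b, c⟩ := t
  obtain ⟨hab, hac, hbc⟩ := ht
  have hbeq (x y : Fin n) : Nat.beq x y = decide (x = y) := by
    rw [Bool.eq_iff_iff, Nat.beq_eq, decide_eq_true_iff, Fin.ext_iff]
  have hor (x y : Fin n) : (Nat.lor (2 ^ x.val) (2 ^ y.val)).testBit w = true ↔ w = x ∨ w = y := by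
    change (2 ^ x.val ||| 2 ^ y.val).testBit w = true ↔ _
    rw [Nat.testBit_or, Bool.or_eq_true, Nat.testBit_two_pow, Nat.testBit_two_pow,
      decide_eq_true_iff, decide_eq_true_iff, Fin.ext_iff, Fin.ext_iff, eq_comm, @eq_comm _ y.val]
  simp only [tripleMask, hbeq, Finset.mem_insert, Finset.mem_singleton]
  dsimp only at hab hac hbc
  by_cases h₁ : v = a
  · subst h₁
    simp only [decide_true, cond_true, hor]
    grind
  by_cases h₂ : v = b
  · subst h₂
    simp only [decide_true, cond_true, decide_eq_false h₁, cond_false, hor]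
    grind
  by_cases h₃ : v = c
  · subst h₃
    simp only [decide_true, cond_true, decide_eq_false h₁, decide_eq_false h₂, cond_false, hor]
    grind
  · simp [h₁, h₂, h₃]

theorem testBit_neighborMask {l : List (Fin n × Fin n × Fin n)}
    (hl : ∀ t ∈ l, t.1 ≠ t.2.1 ∧ t.1 ≠ t.2.2 ∧ t.2.1 ≠ t.2.2) (v w : Fin n) :
    (neighborMask l v).testBit w = true ↔
      v ≠ w ∧ ∃ e ∈ tripleBlocks l, v ∈ e ∧ w ∈ e := by
  have h : (neighborMask l v).testBit w = true ↔ ∃ t ∈ l, (tripleMask t v).testBit w = true := by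
    clear hl
    induction l with
    | nil => simp [neighborMask]
    | cons t l ih =>
      change (tripleMask t v ||| neighborMask l v).testBit w = true ↔ _
      rw [Nat.testBit_or, Bool.or_eq_true, ih]
      simp
  rw [h]
  constructor
  · rintro ⟨t, ht, h⟩
    rw [testBit_tripleMask (hl t ht)] at h
    exact ⟨h.1, _, mem_tripleBlocks.2 ⟨t, ht, rfl⟩, h.2⟩
  · rintro ⟨hvw, e, he, h⟩
    obtain ⟨t, ht, rfl⟩ := mem_tripleBlocks.1 he
    exact ⟨t, ht, (testBit_tripleMask (hl t ht) v w).2 ⟨hvw, h⟩⟩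

theorem neighborMask_lt (l : List (Fin n × Fin n × Fin n)) (v : ℕ) : neighborMask l v < 2 ^ n := by
  have hpow (a : Fin n) : 2 ^ a.val < 2 ^ n := Nat.pow_lt_pow_right (by norm_num) a.2
  induction l with
  | nil => exact (by positivity : 0 < 2 ^ n)
  | cons t l ih =>
    refine Nat.or_lt_two_pow ?_ ih
    rw [tripleMask]
    cases Nat.beq v t.1
    · cases Nat.beq v t.2.1
      · cases Nat.beq v t.2.2
        · exact (by positivity : 0 < 2 ^ n)
        · exact Nat.or_lt_two_pow (hpow _) (hpow _)
      · exact Nat.or_lt_two_pow (hpow _) (hpow _)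
    · exact Nat.or_lt_two_pow (hpow _) (hpow _)

end

namespace TripleSystem

variable {n : ℕ}

/-- The triple system given by a list of triples. -/
def ofTriples (l : List (Fin n × Fin n × Fin n)) (hn : 0 < n)
    (hl : ∀ t ∈ l, t.1 ≠ t.2.1 ∧ t.1 ≠ t.2.2 ∧ t.2.1 ≠ t.2.2)
    (hcover : ∀ v : Fin n, ∃ t ∈ l, v = t.1 ∨ v = t.2.1 ∨ v = t.2.2)
    -- The quantifiers are ordered so that, when this is decided, `b` ranges only over cases where
    -- `c` and `d` are distinct atoms orthogonal to `a`.
    (hunique : ∀ a c : Fin n, (neighborMask l a).testBit c = true →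
      ∀ d : Fin n, (neighborMask l a).testBit d = true → c ≠ d →
      ∀ b : Fin n, a ≠ b → (neighborMask l b).testBit c = true →
        ¬ (neighborMask l b).testBit d = true) : TripleSystem (Fin n) where
  diagram :=
    { atoms_nonempty := ⟨⟨0, hn⟩⟩
      blocks := tripleBlocks l
      block_nonempty := fun e he => by
        obtain ⟨t, -, rfl⟩ := mem_tripleBlocks.1 he
        exact ⟨t.1, by simp⟩ }
  card_three e he := by
    obtain ⟨t, ht, rfl⟩ := mem_tripleBlocks.1 he
    obtain ⟨h₁, h₂, h₃⟩ := hl t ht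
    exact Finset.card_eq_three.2 ⟨_, _, _, h₁, h₂, h₃, rfl⟩
  cover v := by
    obtain ⟨t, ht, hv⟩ := hcover v
    exact ⟨_, mem_tripleBlocks.2 ⟨t, ht, rfl⟩, by simpa using hv⟩
  unique a b c d hab h₁ h₂ h₃ h₄ := by
    rw [← testBit_neighborMask hl] at h₁ h₂ h₃ h₄
    by_contra hcd
    exact hunique a c h₁ d h₃ hcd b hab h₂ h₄

theorem isNeighborMask_ofTriples {l : List (Fin n × Fin n × Fin n)} {hn : 0 < n}
    {hl : ∀ t ∈ l, t.1 ≠ t.2.1 ∧ t.1 ≠ t.2.2 ∧ t.2.1 ≠ t.2.2}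
    {hcover : ∀ v : Fin n, ∃ t ∈ l, v = t.1 ∨ v = t.2.1 ∨ v = t.2.2}
    {hunique : ∀ a c : Fin n, (neighborMask l a).testBit c = true →
      ∀ d : Fin n, (neighborMask l a).testBit d = true → c ≠ d →
      ∀ b : Fin n, a ≠ b → (neighborMask l b).testBit c = true →
        ¬ (neighborMask l b).testBit d = true} :
    IsNeighborMask (ofTriples l hn hl hcover hunique) (neighborMask l) :=
  ⟨fun s _ => neighborMask_lt l s, testBit_neighborMask hl⟩

variable {T : TripleSystem (Fin n)} {nb : ℕ → ℕ}

theorem isTable_elemMask (h : IsNeighborMask T nb) (i : ℕ) :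
    IsTable T 1 (elemMask n nb i) (fun _ => elemAt.{u} T i) := fun j hj t => by
  rw [Nat.lt_one_iff.1 hj, Nat.mul_zero, Nat.zero_add]
  exact testBit_elemMask h i t

/-- A single element is a table with one lane, so the table lemmas apply with `K = 1`. -/
theorem isTable_oaEquivMask (h : IsNeighborMask T nb) {m : ℕ → ℕ} {a : ℕ → Elem.{u} T}
    (ha : ∀ i, IsTable T 1 (m i) (fun _ => a i)) (k : ℕ) {X Y : ℕ} {x y : Elem.{u} T}
    (hX : IsTable T 1 X (fun _ => x)) (hY : IsTable T 1 Y (fun _ => y)) :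
    IsTable T 1 (oaEquivMask n nb m k X Y) (fun _ => Ortholattice.oaEquivAux a k x y) := by
  induction k generalizing X Y x y with
  | zero =>
    exact IsTable.sup h ((hX.sasaki h (ha 3)).land (hY.sasaki h (ha 3)))
      (((hX.compl h).sasaki h (ha 3)).land ((hY.compl h).sasaki h (ha 3)))
  | succ k ih => exact IsTable.sup h (ih hX hY) ((ih hX (ha _)).land (ih hY (ha _)))

theorem not_oaLaw_of_test (h : IsNeighborMask T nb) {k : ℕ} {v : ℕ → ℕ} (t : Fin n)
    (ht : oaViolationTest n nb k v t = true) : ¬ Ortholattice.OALaw k (Elem.{u} T) := by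
  intro hlaw
  have hv (i : ℕ) := isTable_elemMask.{u} h (v i)
  rw [oaViolationTest, Bool.and_eq_true, Bool.not_eq_true', ← Bool.not_eq_true] at ht
  have h₁ := ((hv 1).sasaki h (hv 3)).land (isTable_oaEquivMask h hv (k - 3) (hv 1) (hv 2))
    0 one_pos t
  have h₂ := (hv 2).sasaki h (hv 3) 0 one_pos t
  rw [Nat.mul_zero, Nat.zero_add] at h₁ h₂
  exact ht.2 (h₂.2 ((h₁.1 ht.1).trans (hlaw fun i => elemAt T (v i))))

end TripleSystem

/-! ### The three diagrams -/

namespace TripleSystem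

/-- Ten triples on 17 atoms. -/
def triples17 : List (Fin 17 × Fin 17 × Fin 17) :=
  [(0, 1, 2), (0, 3, 4), (0, 5, 6), (1, 7, 8), (1, 9, 10), (3, 11, 12), (3, 13, 14), (5, 15, 16),
    (7, 11, 15), (9, 13, 16)]

/-- Thirteen triples on 22 atoms. -/
def triples22 : List (Fin 22 × Fin 22 × Fin 22) :=
  [(0, 1, 2), (0, 3, 4), (0, 5, 6), (1, 7, 8), (3, 9, 10), (5, 11, 12), (7, 13, 14), (8, 9, 15),
    (10, 11, 16), (13, 17, 18), (12, 14, 19), (15, 17, 20), (16, 17, 21)]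

/-- Eighteen triples on 28 atoms. -/
def triples28 : List (Fin 28 × Fin 28 × Fin 28) :=
  [(0, 1, 2), (0, 3, 4), (0, 5, 6), (0, 7, 8), (1, 9, 10), (1, 11, 12), (3, 13, 14), (9, 13, 15),
    (11, 14, 16), (3, 17, 18), (5, 15, 19), (7, 16, 20), (17, 19, 21), (17, 20, 22), (5, 23, 24),
    (20, 23, 25), (12, 21, 26), (10, 25, 27)]

/-- The triple system of `triples17`. -/
def system17 : TripleSystem (Fin 17) :=
  ofTriples triples17 (by norm_num) (by simp [triples17]) (by decide +kernel) (by decide +kernel)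

/-- The triple system of `triples22`. -/
def system22 : TripleSystem (Fin 22) :=
  ofTriples triples22 (by norm_num) (by simp [triples22]) (by decide +kernel) (by decide +kernel)

/-- The triple system of `triples28`. -/
def system28 : TripleSystem (Fin 28) :=
  ofTriples triples28 (by norm_num) (by simp [triples28]) (by decide +kernel) (by decide +kernel)

/-- The constants 36, 46 and 58 are the numbers `2 * n + 2` of elements for 17, 22 and 28 atoms. -/
theorem oaLaw_system17 : Ortholattice.OALaw 3 (Elem.{u} system17) :=
  oaLaw_of_test (D := 36) isNeighborMask_ofTriples rfl (by decide +kernel)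

theorem oaLaw_system22 : Ortholattice.OALaw 4 (Elem.{u} system22) :=
  oaLaw_of_test (D := 46) isNeighborMask_ofTriples rfl (by decide +kernel)

theorem oaLaw_system28 : Ortholattice.OALaw 5 (Elem.{u} system28) :=
  oaLaw_of_test (D := 58) isNeighborMask_ofTriples rfl (by decide +kernel)

theorem not_oaLaw_system17 : ¬ Ortholattice.OALaw 4 (Elem.{u} system17) :=
  have : ∃ t : Fin 17, oaViolationTest 17 (neighborMask triples17) 4
      -- Entry 0 is a dummy, as variables start at `a 1`; an index `17 + j` means the coatom of `j`.
      -- Here `a₁ ≡⁽³⁾ a₂` is the atom 9 and the term added by `a₄` is the atom 6. Their join is the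
      -- top, so the left side is the coatom of 13, which is not below the coatom of 16.
      (fun i => [0, 13, 16, 17 + 1, 11].getD i 0) t = true := by decide +kernel
  this.elim fun t => not_oaLaw_of_test isNeighborMask_ofTriples t

theorem not_oaLaw_system22 : ¬ Ortholattice.OALaw 5 (Elem.{u} system22) :=
  have : ∃ t : Fin 22, oaViolationTest 22 (neighborMask triples22) 5
      (fun i => [0, 11, 22 + 14, 22, 7, 9].getD i 0) t = true := by decide +kernel
  this.elim fun t => not_oaLaw_of_test isNeighborMask_ofTriples t

theorem not_oaLaw_system28 : ¬ Ortholattice.OALaw 6 (Elem.{u} system28) :=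
  have : ∃ t : Fin 28, oaViolationTest 28 (neighborMask triples28) 6
      (fun i => [0, 5, 20, 28 + 1, 13, 16, 8].getD i 0) t = true := by decide +kernel
  this.elim fun t => not_oaLaw_of_test isNeighborMask_ofTriples t

theorem hasGreechieWitness {n k m : ℕ} (T : TripleSystem (Fin n)) (hm : T.diagram.blocks.card = m)
    (h₁ : Ortholattice.OALaw k (Elem.{0} T)) (h₂ : ¬ Ortholattice.OALaw (k + 1) (Elem.{0} T)) :
    HasGreechieWitness k n m :=
  ⟨T.diagram, T.isGreechie, T.no_loop_four, hm, Elem.{0} T, inferInstance, Elem.represents T, h₁, h₂⟩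

end TripleSystem

theorem mainTheorem7 :
    (∀ (L : Type u) [Ortholattice L] (n : ℕ), 3 < n →
      Ortholattice.OALaw n L → Ortholattice.OALaw (n - 1) L) ∧
    (∀ n : ℕ, 3 ≤ n → n ≤ 5 →
      ¬ ∀ (L : Type u) [Ortholattice L], Ortholattice.OALaw n L → Ortholattice.OALaw (n + 1) L) ∧
    HasGreechieWitness 3 17 10 ∧ HasGreechieWitness 4 22 13 ∧ HasGreechieWitness 5 28 18 := by
  refine ⟨fun L _ n hn h => h.pred hn, fun n h₁ h₂ h => ?_,
    TripleSystem.hasGreechieWitness .system17 (by decide +kernel) TripleSystem.oaLaw_system17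
      TripleSystem.not_oaLaw_system17,
    TripleSystem.hasGreechieWitness .system22 (by decide +kernel) TripleSystem.oaLaw_system22
      TripleSystem.not_oaLaw_system22,
    TripleSystem.hasGreechieWitness .system28 (by decide +kernel) TripleSystem.oaLaw_system28
      TripleSystem.not_oaLaw_system28⟩
  -- `Elem` exists in every universe over the same diagram, so the three systems also refute the
  -- implication in universe `u`.
  interval_cases n
  · exact TripleSystem.not_oaLaw_system17 (h _ TripleSystem.oaLaw_system17)
  · exact TripleSystem.not_oaLaw_system22 (h _ TripleSystem.oaLaw_system22)
  · exact TripleSystem.not_oaLaw_system28 (h _ TripleSystem.oaLaw_system28)
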